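/- Let $\Sigma$ be any rational complete fan in $\mathbb{R}^3$. Then there is a complete unimodular fan $\Sigma'$ in $\mathbb{R}^3$ that refines $\Sigma$ and such that $\Sigma'$ is not a blow-up of any unimodular fan. Moreover, if $\Sigma$ is polytopal, then $\Sigma'$ can be chosen polytopal too. Here a fan is a finite nonempty collection of polyhedral cones, closed under taking faces, in which any two cones meet in a common face. A fan is complete if its cones cover the space, and rational if each of its cones is generated by integer vectors. A complete fan is polytopal if it is the normal fan of a polytope. A rational simplicial cone with primitive generators $\alpha_1,\dots,\alpha_k$ is unimodular if $\alpha_1,\dots,\alpha_k$ generate the lattice of all integer points in their linear span. A fan is unimodular if all its cones are unimodular and it contains a full-dimensional cone. A complete fan $\Sigma'$ refines a complete fan $\Sigma$ if every cone of $\Sigma'$ is contained in a cone of $\Sigma$. The blow-up of a fan $\Sigma_0$ at a unimodular cone $C\in\Sigma_0$ of dimension $k\ge 2$ with primitive generators $\alpha_1,\dots,\alpha_k$ is the stellar subdivision of $\Sigma_0$ by $\gamma=\alpha_1+\cdots+\alpha_k$, that is, the fan consisting of the cones of $\Sigma_0$ that do not contain $\gamma$ and of the cones $\operatorname{Cone}(C_0\cup\{\gamma\})$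 for $C_0\in\Sigma_0$ with $\gamma\notin C_0$ such that some $C'\in\Sigma_0$ contains $C_0\cup\{\gamma\}$. -/

import Mathlib

/-- A polyhedral fan in `ℝⁿ`: a finite (nonempty) complex of polyhedral cones, closed under taking
faces, in which any two cones intersect in a common face. The cones are allowed to have a
nontrivial lineality space. -/
structure PolyhedralFan (n : ℕ) where
  /-- The cones of the fan. -/
  cones : Set (PointedCone ℝ (Fin n → ℝ))
  finite : cones.Finite
  nonempty : cones.Nonempty
  polyhedral : ∀ C ∈ cones, C.FG
  face_mem : ∀ C ∈ cones, ∀ F : PointedCone ℝ (Fin n → ℝ), F.IsFaceOf C → F ∈ cones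
  inf_isFaceOf_left : ∀ C ∈ cones, ∀ D ∈ cones, (C ⊓ D).IsFaceOf C
  inf_isFaceOf_right : ∀ C ∈ cones, ∀ D ∈ cones, (C ⊓ D).IsFaceOf D

namespace PolyhedralFan

/-- The inclusion of the lattice `ℤⁿ` in `ℝⁿ`. -/
def latticeHom (n : ℕ) : (Fin n → ℤ) →+ (Fin n → ℝ) :=
  (Int.castAddHom ℝ).compLeft (Fin n)

/-- An integer vector is primitive if its entries are relatively prime. In particular it is
nonzero. -/
def IsPrimitive {n : ℕ} (v : Fin n → ℤ) : Prop :=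
  Finset.univ.gcd v = 1

/-- A cone is rational if it is generated by finitely many integer vectors. -/
def IsRationalCone {n : ℕ} (C : PointedCone ℝ (Fin n → ℝ)) : Prop :=
  ∃ s : Finset (Fin n → ℤ), C = PointedCone.hull ℝ (latticeHom n '' (s : Set (Fin n → ℤ)))

/-- A cone is full-dimensional if it spans the ambient space linearly. -/
def IsFullDimCone {n : ℕ} (C : PointedCone ℝ (Fin n → ℝ)) : Prop :=
  Submodule.span ℝ (C : Set (Fin n → ℝ)) = ⊤

/-- `α₁, …, α_k` are the primitive generators of the rational simplicial cone `C`: they are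
primitive integer vectors, linearly independent, and they generate `C`. -/
structure IsPrimitiveGenerators {n k : ℕ} (α : Fin k → Fin n → ℤ)
    (C : PointedCone ℝ (Fin n → ℝ)) : Prop where
  primitive : ∀ i, IsPrimitive (α i)
  linearIndependent : LinearIndependent ℝ (fun i => latticeHom n (α i))
  hull_eq : PointedCone.hull ℝ (Set.range fun i => latticeHom n (α i)) = C

/-- The multiplicity of the simplicial cone generated by `α₁, …, α_k`: the index of the lattice
generated by the `α_i` in the lattice of all integer vectors in their real linear span. -/
noncomputable def coneMultiplicity {n k : ℕ} (α : Fin k → Fin n → ℤ) : ℕ :=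
  (AddSubgroup.closure (Set.range α)).relIndex
    ((Submodule.span ℝ (Set.range fun i => latticeHom n (α i))).toAddSubgroup.comap
      (latticeHom n))

/-- `C` is a unimodular (rational, simplicial) cone with primitive generators `α₁, …, α_k`. -/
def IsUnimodularGenerators {n k : ℕ} (α : Fin k → Fin n → ℤ)
    (C : PointedCone ℝ (Fin n → ℝ)) : Prop :=
  IsPrimitiveGenerators α C ∧ coneMultiplicity α = 1

/-- A unimodular cone: a rational simplicial cone of multiplicity one. -/
def IsUnimodularCone {n : ℕ} (C : PointedCone ℝ (Fin n → ℝ)) : Prop :=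
  ∃ (k : ℕ) (α : Fin k → Fin n → ℤ), IsUnimodularGenerators α C

/-- A fan is rational if all of its cones are rational. -/
def IsRational {n : ℕ} (S : PolyhedralFan n) : Prop :=
  ∀ C ∈ S.cones, IsRationalCone C

/-- A fan is complete if its cones cover the space. -/
def IsComplete {n : ℕ} (S : PolyhedralFan n) : Prop :=
  ∀ x : Fin n → ℝ, ∃ C ∈ S.cones, x ∈ C

/-- A unimodular fan: a full-dimensional fan all of whose cones are rational, simplicial and of
multiplicity one. -/
structure IsUnimodular {n : ℕ} (S : PolyhedralFan n) : Prop where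
  fullDim : ∃ C ∈ S.cones, IsFullDimCone C
  unimodular : ∀ C ∈ S.cones, IsUnimodularCone C

/-- `T` refines `S` if every cone of `T` is contained in some cone of `S`. -/
def Refines {n : ℕ} (T S : PolyhedralFan n) : Prop :=
  ∀ D ∈ T.cones, ∃ C ∈ S.cones, D ≤ C

/-- The cones of the stellar subdivision of `S` by the vector `γ`: the cones of `S` that do not
contain `γ`, and the cones generated by `γ` and `C`, for each cone `C` of `S` that does not contain
`γ` but is contained, together with `γ`, in a cone of `S`. -/
def stellarCones {n : ℕ} (S : PolyhedralFan n) (γ : Fin n → ℝ) :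
    Set (PointedCone ℝ (Fin n → ℝ)) :=
  {C | C ∈ S.cones ∧ γ ∉ C} ∪
    {D | ∃ C ∈ S.cones, γ ∉ C ∧ (∃ C' ∈ S.cones, C ≤ C' ∧ γ ∈ C') ∧
      D = PointedCone.hull ℝ (insert γ (C : Set (Fin n → ℝ)))}

/-- `T` is a blow-up of `S`: for some unimodular cone `C` of `S` with primitive generators
`α₁, …, α_k`, `k ≥ 2`, the fan `T` is the stellar subdivision of `S` by `α₁ + ⋯ + α_k`.
(For `k = 1` this stellar subdivision is `S` itself, and for `k = 0` it has no cones.) -/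
def IsBlowUp {n : ℕ} (T S : PolyhedralFan n) : Prop :=
  ∃ C ∈ S.cones, ∃ (k : ℕ) (α : Fin k → Fin n → ℤ), 2 ≤ k ∧ IsUnimodularGenerators α C ∧
    T.cones = S.stellarCones (latticeHom n (∑ i, α i))

/-- The face of `P` in the direction of `a`: the points of `P` at which the linear functional
given by `a` is maximal on `P`. -/
def faceInDirection {n : ℕ} (P : Set (Fin n → ℝ)) (a : Fin n → ℝ) : Set (Fin n → ℝ) :=
  {p ∈ P | ∀ x ∈ P, 0 ≤ a ⬝ᵥ (p - x)}

/-- The normal cone of `F` in `P`, where the dual space is identified with `ℝⁿ` through the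
standard scalar product. -/
def normalCone {n : ℕ} (P F : Set (Fin n → ℝ)) : PointedCone ℝ (Fin n → ℝ) where
  carrier := {a | ∀ p ∈ F, ∀ q ∈ P, 0 ≤ a ⬝ᵥ (p - q)}
  add_mem' := by
    intro a b ha hb p hp q hq
    rw [add_dotProduct]
    exact add_nonneg (ha p hp q hq) (hb p hp q hq)
  zero_mem' := by
    intro p _ q _
    simp
  smul_mem' := by
    intro c a ha p hp q hq
    change 0 ≤ ((c : ℝ) • a) ⬝ᵥ (p - q)
    rw [smul_dotProduct]
    exact mul_nonneg c.2 (ha p hp q hq)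

/-- A fan is polytopal if it is the normal fan of a polytope, that is, if its cones are the normal
cones of the faces of the convex hull of some finite nonempty set of points. -/
def IsPolytopal {n : ℕ} (S : PolyhedralFan n) : Prop :=
  ∃ V : Finset (Fin n → ℝ), V.Nonempty ∧
    S.cones = Set.range fun a : Fin n → ℝ =>
      normalCone (convexHull ℝ (V : Set (Fin n → ℝ)))
        (faceInDirection (convexHull ℝ (V : Set (Fin n → ℝ))) a)

end PolyhedralFan

/-!
Start from the fan of the `2ⁿ` orthants and subdivide it stellarly, first at lattice points of the
hyperplanes spanned by generators of cones of `S` and unit vectors, until every cone lies on one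
side of each of these hyperplanes and hence in a cone of `S`; then at lattice points witnessing a
determinant other than `±1`, until all cones are unimodular. Finally subdivide every maximal cone of
the resulting fan in `ℝ³` by one and the same unimodular pattern of 21 cones, which leaves the
proper faces intact. A blow-up introduces a ray that is the sum of the two or three generators of
the cone blown up, and every maximal cone at the new ray contains all but at most one of these
generators. The pattern is chosen such that none of its rays can arise in this way.

All these fans carry a strictly convex piecewise linear function: such a function is extended to a
subdivision by adding a small multiple of a function that is strictly convex on each of the old
cones. So the final fan is the normal fan of a polytope.
-/

namespace PolyhedralFan

open Matrix Filter Topology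

universe u v w

variable {n : ℕ} {ι : Type u} {ι' : Type v} {ι'' : Type w}

theorem latticeHom_apply (v : Fin n → ℤ) (i : Fin n) : latticeHom n v i = (v i : ℝ) := rfl

theorem latticeHom_injective : Function.Injective (latticeHom n) := fun v w h => by
  funext i
  simpa [latticeHom_apply] using congrFun h i

theorem latticeHom_ne_zero {v : Fin n → ℤ} (hv : v ≠ 0) : latticeHom n v ≠ 0 :=
  (map_ne_zero_iff _ latticeHom_injective).2 hv

theorem latticeHom_smul (c : ℤ) (v : Fin n → ℤ) :
    latticeHom n (c • v) = (c : ℝ) • latticeHom n v := by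
  funext i
  simp [latticeHom_apply]

theorem latticeHom_vecMul (c : Fin n → ℤ) (A : Matrix (Fin n) (Fin n) ℤ) :
    latticeHom n (c ᵥ* A) = ∑ k, (c k : ℝ) • latticeHom n (A k) := by
  simp only [vecMul_eq_sum, map_sum, latticeHom_smul]

section Coords

variable {A B : Matrix (Fin n) (Fin n) ℤ}

/-- The coordinates of a vector with respect to the rows of `A`, meaningful when `A.det ≠ 0`.
The simplicial cone spanned by the rows of `A` is `{x | 0 ≤ coords A x}`. -/
noncomputable def coords (A : Matrix (Fin n) (Fin n) ℤ) : (Fin n → ℝ) →ₗ[ℝ] (Fin n → ℝ) :=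
  (A.map (Int.cast : ℤ → ℝ))⁻¹.vecMulLinear

theorem det_map_intCast (A : Matrix (Fin n) (Fin n) ℤ) :
    (A.map (Int.cast : ℤ → ℝ)).det = A.det :=
  ((Int.castRingHom ℝ).map_det A).symm

theorem isUnit_det_map_intCast (hA : A.det ≠ 0) : IsUnit (A.map (Int.cast : ℤ → ℝ)).det := by
  simpa [det_map_intCast] using hA

theorem sum_smul_row (c : Fin n → ℝ) :
    ∑ k, c k • latticeHom n (A k) = c ᵥ* A.map (Int.cast : ℤ → ℝ) :=
  (vecMul_eq_sum _ _).symm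

theorem sum_coords (hA : A.det ≠ 0) (x : Fin n → ℝ) :
    ∑ k, coords A x k • latticeHom n (A k) = x := by
  rw [sum_smul_row, coords, vecMulLinear_apply, vecMul_vecMul,
    nonsing_inv_mul _ (isUnit_det_map_intCast hA), vecMul_one]

theorem coords_sum (hA : A.det ≠ 0) (c : Fin n → ℝ) :
    coords A (∑ k, c k • latticeHom n (A k)) = c := by
  rw [sum_smul_row, coords, vecMulLinear_apply, vecMul_vecMul,
    mul_nonsing_inv _ (isUnit_det_map_intCast hA), vecMul_one]

theorem coords_eq_of_sum_eq (hA : A.det ≠ 0) {c x : Fin n → ℝ}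
    (h : ∑ k, c k • latticeHom n (A k) = x) : coords A x = c := by
  rw [← h, coords_sum hA]

theorem coords_injective (hA : A.det ≠ 0) : Function.Injective (coords A) := fun x y h => by
  rw [← sum_coords hA x, ← sum_coords hA y, h]

theorem coords_row (hA : A.det ≠ 0) (k : Fin n) :
    coords A (latticeHom n (A k)) = Pi.single k 1 :=
  coords_eq_of_sum_eq hA (by simp [Pi.single_apply])

theorem coords_row_nonneg (hA : A.det ≠ 0) (k : Fin n) : 0 ≤ coords A (latticeHom n (A k)) := by
  rw [coords_row hA]
  exact Pi.single_nonneg.2 zero_le_one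

theorem coords_latticeHom_vecMul (hA : A.det ≠ 0) (c : Fin n → ℤ) :
    coords A (latticeHom n (c ᵥ* A)) = latticeHom n c := by
  rw [latticeHom_vecMul]
  exact coords_sum hA _

theorem row_injective (hA : A.det ≠ 0) : Function.Injective A := fun k l h => by
  have hkl := coords_row hA k
  rw [h, coords_row hA l] at hkl
  by_contra hne
  simpa [hne] using congrFun hkl k

theorem linearIndependent_rows (hA : A.det ≠ 0) :
    LinearIndependent ℝ fun k => latticeHom n (A k) := by
  rw [Fintype.linearIndependent_iff]
  intro c hc k
  simpa using (congrFun (coords_eq_of_sum_eq hA hc) k).symm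

theorem map_eq_sum_coords (hA : A.det ≠ 0) (f : Module.Dual ℝ (Fin n → ℝ)) (x : Fin n → ℝ) :
    f x = ∑ k, coords A x k * f (latticeHom n (A k)) := by
  conv_lhs => rw [← sum_coords hA x]
  simp only [map_sum, map_smul, smul_eq_mul]

theorem coords_nonneg_of_rows (hB : B.det ≠ 0) (h : ∀ k, 0 ≤ coords A (latticeHom n (B k)))
    {x : Fin n → ℝ} (hx : 0 ≤ coords B x) : 0 ≤ coords A x := by
  rw [← sum_coords hB x, map_sum]
  refine Finset.sum_nonneg fun k _ => ?_
  rw [map_smul]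
  exact smul_nonneg (hx k) (h k)

theorem det_updateRow_eq (hA : A.det ≠ 0) (k : Fin n) (γ : Fin n → ℤ) :
    ((A.updateRow k γ).det : ℝ) = coords A (latticeHom n γ) k * A.det := by
  have hrow : (A.updateRow k γ).map (Int.cast : ℤ → ℝ) = (A.map (Int.cast : ℤ → ℝ)).updateRow k
      (∑ m, coords A (latticeHom n γ) m • (A.map (Int.cast : ℤ → ℝ)) m) := by
    rw [show ∑ m, coords A (latticeHom n γ) m • (A.map (Int.cast : ℤ → ℝ)) m = latticeHom n γ from
      sum_coords hA _, map_updateRow]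
    rfl
  rw [← det_map_intCast, ← det_map_intCast, hrow, det_updateRow_sum, smul_eq_mul]

theorem det_updateRow_ne_zero (hA : A.det ≠ 0) {k : Fin n} {γ : Fin n → ℤ}
    (hk : coords A (latticeHom n γ) k ≠ 0) : (A.updateRow k γ).det ≠ 0 := by
  rw [← Int.cast_ne_zero (α := ℝ), det_updateRow_eq hA k γ]
  exact mul_ne_zero hk (Int.cast_ne_zero.2 hA)

theorem coords_updateRow (hA : A.det ≠ 0) {k : Fin n} {γ : Fin n → ℤ}
    (hk : coords A (latticeHom n γ) k ≠ 0) (x : Fin n → ℝ) :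
    coords (A.updateRow k γ) x =
      Function.update (coords A x - (coords A x k / coords A (latticeHom n γ) k) •
        coords A (latticeHom n γ)) k (coords A x k / coords A (latticeHom n γ) k) := by
  refine coords_eq_of_sum_eq (det_updateRow_ne_zero hA hk) ?_
  set G := coords A (latticeHom n γ)
  set t := coords A x k / G k with ht
  have hsummand : ∀ m, Function.update (coords A x - t • G) k t m •
      latticeHom n (A.updateRow k γ m) =
      (coords A x - t • G) m • latticeHom n (A m) + if m = k then t • latticeHom n γ else 0 := by
    intro m
    rcases eq_or_ne m k with rfl | hm
    · simp [ht, div_mul_cancel₀ _ hk]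
    · simp [hm]
  simp only [hsummand, Finset.sum_add_distrib, Finset.sum_ite_eq', Finset.mem_univ, if_true,
    Pi.sub_apply, Pi.smul_apply, smul_eq_mul, sub_smul, Finset.sum_sub_distrib, mul_smul,
    ← Finset.smul_sum, sum_coords hA, G, sub_add_cancel]

theorem coords_eq_sum_of_rows (hA : A.det ≠ 0) (hB : B.det ≠ 0) {x : Fin n → ℝ}
    (h : ∀ k, coords A x k ≠ 0 → A k ∈ Set.range B) (l : Fin n) :
    coords B x l = ∑ k, if B l = A k then coords A x k else 0 := by
  refine congrFun (coords_eq_of_sum_eq hB (c := fun l => ∑ k, if B l = A k then coords A x k else 0)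
    ?_) l
  conv_rhs => rw [← sum_coords hA x]
  simp only [Finset.sum_smul]
  rw [Finset.sum_comm]
  refine Finset.sum_congr rfl fun k _ => ?_
  by_cases hk : coords A x k = 0
  · simp [hk]
  · obtain ⟨l, hl⟩ := h k hk
    simp [← hl, (row_injective hB).eq_iff]

theorem coords_eq_of_row_eq (hA : A.det ≠ 0) (hB : B.det ≠ 0) {x : Fin n → ℝ}
    (h : ∀ k, coords A x k ≠ 0 → A k ∈ Set.range B) {k l : Fin n} (hkl : B l = A k) :
    coords B x l = coords A x k := by
  simp [coords_eq_sum_of_rows hA hB h, hkl, (row_injective hA).eq_iff]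

theorem coords_nonneg_of_support (hA : A.det ≠ 0) (hB : B.det ≠ 0) {x : Fin n → ℝ}
    (hx : 0 ≤ coords A x) (h : ∀ k, coords A x k ≠ 0 → A k ∈ Set.range B) : 0 ≤ coords B x := by
  intro l
  rw [coords_eq_sum_of_rows hA hB h]
  refine Finset.sum_nonneg fun k _ => ?_
  split_ifs
  exacts [hx k, le_rfl]

end Coords

section ConvexFan

variable {g : ι → Matrix (Fin n) (Fin n) ℤ} {g' : ι' → Matrix (Fin n) (Fin n) ℤ}
  {g'' : ι'' → Matrix (Fin n) (Fin n) ℤ} {y : ι → Module.Dual ℝ (Fin n → ℝ)}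

/-- The linear functionals `y i` are the pieces of a strictly convex function on the cones spanned
by the rows of the matrices `g i`: on the rows of `g i` the largest of them is `y i`, and the others
that attain the same value at a row `v` are those of the cones with generator `v`. -/
structure IsSupport (g : ι → Matrix (Fin n) (Fin n) ℤ) (y : ι → Module.Dual ℝ (Fin n → ℝ)) :
    Prop where
  le : ∀ i j k, y j (latticeHom n (g i k)) ≤ y i (latticeHom n (g i k))
  eq_iff : ∀ i j k,
    y j (latticeHom n (g i k)) = y i (latticeHom n (g i k)) ↔ g i k ∈ Set.range (g j)

/-- The rows of the matrices `g i` generate the maximal cones of a complete simplicial fan with a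
strictly convex support function. -/
structure IsConvexFan (g : ι → Matrix (Fin n) (Fin n) ℤ) : Prop where
  det_ne_zero : ∀ i, (g i).det ≠ 0
  cover : ∀ x : Fin n → ℝ, ∃ i, 0 ≤ coords (g i) x
  exists_isSupport : ∃ y, IsSupport g y

theorem IsSupport.map_le (hy : IsSupport g y) {i : ι} (hi : (g i).det ≠ 0) (j : ι)
    {x : Fin n → ℝ} (hx : 0 ≤ coords (g i) x) : y j x ≤ y i x := by
  rw [map_eq_sum_coords hi (y j), map_eq_sum_coords hi (y i)]
  exact Finset.sum_le_sum fun k _ => mul_le_mul_of_nonneg_left (hy.le i j k) (hx k)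

theorem IsSupport.mem_range_of_map_eq (hy : IsSupport g y) {i j : ι} (hi : (g i).det ≠ 0)
    {x : Fin n → ℝ} (hx : 0 ≤ coords (g i) x) (h : y j x = y i x) {k : Fin n}
    (hk : coords (g i) x k ≠ 0) : g i k ∈ Set.range (g j) := by
  rw [← hy.eq_iff]
  rw [map_eq_sum_coords hi (y j), map_eq_sum_coords hi (y i), Finset.sum_eq_sum_iff_of_le
    fun k _ => mul_le_mul_of_nonneg_left (hy.le i j k) (hx k)] at h
  exact mul_left_cancel₀ hk (h k (Finset.mem_univ k))

theorem IsSupport.map_eq_iff (hy : IsSupport g y) {i j : ι} (hi : (g i).det ≠ 0)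
    (hj : (g j).det ≠ 0) {x : Fin n → ℝ} (hx : 0 ≤ coords (g i) x) :
    y j x = y i x ↔ 0 ≤ coords (g j) x :=
  ⟨fun h => coords_nonneg_of_support hi hj hx fun _ => hy.mem_range_of_map_eq hi hx h,
    fun h => (hy.map_le hi j hx).antisymm (hy.map_le hj i h)⟩

theorem IsConvexFan.exists_row (hg : IsConvexFan g) {i j : ι} {x : Fin n → ℝ}
    (hi : 0 ≤ coords (g i) x) (hj : 0 ≤ coords (g j) x) {k : Fin n} (hk : coords (g i) x k ≠ 0) :
    ∃ l, g j l = g i k ∧ coords (g j) x l = coords (g i) x k := by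
  obtain ⟨y, hy⟩ := hg.exists_isSupport
  have hrow : ∀ m, coords (g i) x m ≠ 0 → g i m ∈ Set.range (g j) := fun m =>
    hy.mem_range_of_map_eq (hg.det_ne_zero i) hi
      ((hy.map_eq_iff (hg.det_ne_zero i) (hg.det_ne_zero j) hi).2 hj)
  obtain ⟨l, hl⟩ := hrow k hk
  exact ⟨l, hl, coords_eq_of_row_eq (hg.det_ne_zero i) (hg.det_ne_zero j) hrow hl⟩

theorem IsConvexFan.row_mem_range (hg : IsConvexFan g) {i j : ι} {k : Fin n}
    (h : 0 ≤ coords (g j) (latticeHom n (g i k))) : g i k ∈ Set.range (g j) := by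
  obtain ⟨l, hl, -⟩ := hg.exists_row (coords_row_nonneg (hg.det_ne_zero i) k) h (k := k)
    (by simp [coords_row (hg.det_ne_zero i)])
  exact ⟨l, hl⟩

/-- Every cone of `g'` lies in a cone of `g`. -/
def Finer (g' : ι' → Matrix (Fin n) (Fin n) ℤ) (g : ι → Matrix (Fin n) (Fin n) ℤ) : Prop :=
  ∀ i', ∃ i, ∀ k, 0 ≤ coords (g i) (latticeHom n (g' i' k))

theorem Finer.refl (hg : ∀ i, (g i).det ≠ 0) : Finer g g := fun i =>
  ⟨i, coords_row_nonneg (hg i)⟩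

theorem Finer.trans (hg' : ∀ i, (g' i).det ≠ 0) (h : Finer g'' g') (h' : Finer g' g) :
    Finer g'' g := fun i => by
  obtain ⟨j, hj⟩ := h i
  obtain ⟨l, hl⟩ := h' j
  exact ⟨l, fun k => coords_nonneg_of_rows (hg' j) hl (hj k)⟩

-- The support function of the subdivision is that of `g` plus a small multiple of `z`.
theorem IsConvexFan.of_subdivision [Finite ι'] (hg : IsConvexFan g)
    (hdet : ∀ p, (g' p).det ≠ 0) (hcover : ∀ x : Fin n → ℝ, ∃ p, 0 ≤ coords (g' p) x)
    {π : ι' → ι} (hπ : ∀ p k, 0 ≤ coords (g (π p)) (latticeHom n (g' p k)))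
    {z : ι' → Module.Dual ℝ (Fin n → ℝ)}
    (hz : ∀ p q k, 0 ≤ coords (g (π q)) (latticeHom n (g' p k)) →
      z q (latticeHom n (g' p k)) ≤ z p (latticeHom n (g' p k)) ∧
      (z q (latticeHom n (g' p k)) = z p (latticeHom n (g' p k)) ↔
        g' p k ∈ Set.range (g' q))) :
    IsConvexFan g' := by
  obtain ⟨y, hy⟩ := hg.exists_isSupport
  have hlocal : ∀ p q k, ∀ᶠ ε in 𝓝[>] (0 : ℝ),
      (y (π q) + ε • z q) (latticeHom n (g' p k)) ≤ (y (π p) + ε • z p) (latticeHom n (g' p k)) ∧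
      ((y (π q) + ε • z q) (latticeHom n (g' p k)) = (y (π p) + ε • z p) (latticeHom n (g' p k)) ↔
        g' p k ∈ Set.range (g' q)) := by
    intro p q k
    have hle := hy.map_le (hg.det_ne_zero (π p)) (π q) (hπ p k)
    have heq := hy.map_eq_iff (hg.det_ne_zero (π p)) (hg.det_ne_zero (π q)) (hπ p k)
    by_cases hq : 0 ≤ coords (g (π q)) (latticeHom n (g' p k))
    · filter_upwards [self_mem_nhdsWithin] with ε (hε : 0 < ε)
      simpa [heq.2 hq, hε, hε.ne'] using hz p q k hq
    · have hlim : ∀ r, Tendsto (fun ε : ℝ => (y (π r) + ε • z r) (latticeHom n (g' p k))) (𝓝[>] 0)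
          (𝓝 (y (π r) (latticeHom n (g' p k)))) := fun r => by
        refine Tendsto.mono_left ?_ nhdsWithin_le_nhds
        exact Continuous.tendsto'
          (by simp only [LinearMap.add_apply, LinearMap.smul_apply]; fun_prop)
          _ _ (by simp)
      have hrange : g' p k ∉ Set.range (g' q) := by
        rintro ⟨l, hl⟩
        exact hq (hl ▸ hπ q l)
      filter_upwards [(hlim q).eventually_lt (hlim p) (hle.lt_of_ne (mt heq.1 hq))] with ε hε
      exact ⟨hε.le, iff_of_false hε.ne hrange⟩
  obtain ⟨ε, hε⟩ := (eventually_all.2 fun p => eventually_all.2 fun q =>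
    eventually_all.2 (hlocal p q)).exists
  exact ⟨hdet, hcover, fun p => y (π p) + ε • z p, fun p q k => (hε p q k).1,
    fun p q k => (hε p q k).2⟩

end ConvexFan

section Stellar

variable {g : ι → Matrix (Fin n) (Fin n) ℤ} {γ : Fin n → ℤ}

/-- The index set of the stellar subdivision at `γ`: the cones that do not contain `γ`, and the
cones containing `γ` together with a generator to be replaced by `γ`. -/
abbrev StellarIndex (g : ι → Matrix (Fin n) (Fin n) ℤ) (γ : Fin n → ℤ) : Type u :=
  {i // ¬ 0 ≤ coords (g i) (latticeHom n γ)} ⊕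
    {p : ι × Fin n // 0 ≤ coords (g p.1) (latticeHom n γ) ∧
      0 < coords (g p.1) (latticeHom n γ) p.2}

/-- The maximal cones of the stellar subdivision at `γ`. -/
def stellarGen (g : ι → Matrix (Fin n) (Fin n) ℤ) (γ : Fin n → ℤ) :
    StellarIndex g γ → Matrix (Fin n) (Fin n) ℤ :=
  Sum.elim (fun i => g i.1) fun p => (g p.1.1).updateRow p.1.2 γ

/-- The index of the cone that a cone of the stellar subdivision comes from. -/
def stellarParent (g : ι → Matrix (Fin n) (Fin n) ℤ) (γ : Fin n → ℤ) : StellarIndex g γ → ι :=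
  Sum.elim (fun i => i.1) fun p => p.1.1

theorem stellarGen_det_ne_zero (hg : ∀ i, (g i).det ≠ 0) :
    ∀ p, (stellarGen g γ p).det ≠ 0
  | .inl i => hg i.1
  | .inr p => det_updateRow_ne_zero (hg p.1.1) p.2.2.ne'

theorem coords_stellarParent_nonneg (hg : ∀ i, (g i).det ≠ 0) (p : StellarIndex g γ) (k : Fin n) :
    0 ≤ coords (g (stellarParent g γ p)) (latticeHom n (stellarGen g γ p k)) := by
  rcases p with i | ⟨⟨i, l⟩, hi, -⟩
  · exact coords_row_nonneg (hg i.1) k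
  · rcases eq_or_ne k l with rfl | hk
    · simpa [stellarParent, stellarGen] using hi
    · simpa [stellarParent, stellarGen, updateRow_ne hk] using coords_row_nonneg (hg i) k

theorem stellarGen_finer (hg : ∀ i, (g i).det ≠ 0) : Finer (stellarGen g γ) g := fun p =>
  ⟨stellarParent g γ p, coords_stellarParent_nonneg hg p⟩

-- The row to be replaced is the one that leaves the basis in the ratio test of linear programming.
theorem exists_coords_updateRow_nonneg {A : Matrix (Fin n) (Fin n) ℤ} (hA : A.det ≠ 0)
    (hγ : γ ≠ 0) (hAγ : 0 ≤ coords A (latticeHom n γ)) {x : Fin n → ℝ} (hx : 0 ≤ coords A x) :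
    ∃ k, 0 < coords A (latticeHom n γ) k ∧ 0 ≤ coords (A.updateRow k γ) x := by
  set G := coords A (latticeHom n γ) with hG
  have hG0 : G ≠ 0 := fun h =>
    latticeHom_ne_zero hγ (coords_injective hA (by rw [← hG, h, map_zero]))
  obtain ⟨k₀, hk₀⟩ : ∃ k, 0 < G k := (Pi.lt_def.1 (hAγ.lt_of_ne hG0.symm)).2
  obtain ⟨k, hk, hmin⟩ := Finset.exists_min_image {k | 0 < G k} (fun k => coords A x k / G k)
    ⟨k₀, by simpa using hk₀⟩
  simp only [Finset.mem_filter, Finset.mem_univ, true_and] at hk hmin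
  refine ⟨k, hk, fun m => ?_⟩
  rw [coords_updateRow hA hk.ne', ← hG]
  rcases eq_or_ne m k with rfl | hmk
  · simpa using div_nonneg (hx m) hk.le
  · simp only [Function.update_of_ne hmk, Pi.sub_apply, Pi.smul_apply, smul_eq_mul, Pi.zero_apply,
      sub_nonneg]
    rcases (hAγ m).eq_or_lt with hm | hm
    · simpa [← hm] using hx m
    · exact (le_div_iff₀ hm).1 (hmin m hm)

theorem stellarGen_cover (hg : IsConvexFan g) (hγ : γ ≠ 0) (x : Fin n → ℝ) :
    ∃ p, 0 ≤ coords (stellarGen g γ p) x := by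
  obtain ⟨i, hi⟩ := hg.cover x
  by_cases h : 0 ≤ coords (g i) (latticeHom n γ)
  · obtain ⟨k, hk, hx⟩ := exists_coords_updateRow_nonneg (hg.det_ne_zero i) hγ h hi
    exact ⟨.inr ⟨(i, k), h, hk⟩, hx⟩
  · exact ⟨.inl ⟨i, h⟩, hi⟩

/-- The piecewise linear function that is `-1` at `γ` and vanishes at all other rays of the stellar
subdivision at `γ`, given by its linear pieces. -/
noncomputable def stellarBump (g : ι → Matrix (Fin n) (Fin n) ℤ) (γ : Fin n → ℤ) :
    StellarIndex g γ → Module.Dual ℝ (Fin n → ℝ) :=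
  Sum.elim 0 fun p =>
    -(coords (g p.1.1) (latticeHom n γ) p.1.2)⁻¹ • LinearMap.proj p.1.2 ∘ₗ coords (g p.1.1)

theorem stellarBump_eq (hg : ∀ i, (g i).det ≠ 0) (p : StellarIndex g γ) (k : Fin n) :
    stellarBump g γ p (latticeHom n (stellarGen g γ p k)) =
      if stellarGen g γ p k = γ then -1 else 0 := by
  rcases p with ⟨i, hi⟩ | ⟨⟨i, l⟩, hi, hl⟩
  · have hne : g i k ≠ γ := fun h => hi (h ▸ coords_row_nonneg (hg i) k)
    simp [stellarBump, stellarGen, hne]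
  · rcases eq_or_ne k l with rfl | hk
    · simp [stellarBump, stellarGen, hl.ne']
    · have hne : g i k ≠ γ := by
        rintro rfl
        simp [coords_row (hg i), hk.symm] at hl
      simp [stellarBump, stellarGen, updateRow_ne hk, hne, coords_row (hg i), hk.symm]

theorem stellarGen_eq_or_exists_row (p : StellarIndex g γ) (k : Fin n) :
    stellarGen g γ p k = γ ∨ ∃ i l, stellarGen g γ p k = g i l := by
  rcases p with i | ⟨⟨i, l⟩, -⟩
  · exact .inr ⟨i.1, k, rfl⟩
  · rcases eq_or_ne k l with rfl | hk
    · exact .inl updateRow_self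
    · exact .inr ⟨i, k, updateRow_ne hk⟩

theorem row_mem_range_updateRow_iff {A : Matrix (Fin n) (Fin n) ℤ} (hA : A.det ≠ 0) {k l : Fin n}
    (hl : A l ≠ γ) : A l ∈ Set.range (A.updateRow k γ) ↔ l ≠ k := by
  refine ⟨?_, fun h => ⟨l, updateRow_ne h⟩⟩
  rintro ⟨r, hr⟩ rfl
  rcases eq_or_ne r l with rfl | hrl
  · exact hl (by rw [← hr, updateRow_self])
  · rw [updateRow_ne hrl] at hr
    exact hrl (row_injective hA hr)

theorem stellarBump_le_iff (hg : IsConvexFan g) (q : StellarIndex g γ) {v : Fin n → ℤ}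
    (hv : v = γ ∨ ∃ i l, v = g i l)
    (hq : 0 ≤ coords (g (stellarParent g γ q)) (latticeHom n v)) :
    stellarBump g γ q (latticeHom n v) ≤ (if v = γ then -1 else 0) ∧
      (stellarBump g γ q (latticeHom n v) = (if v = γ then -1 else 0) ↔
        v ∈ Set.range (stellarGen g γ q)) := by
  rcases eq_or_ne v γ with rfl | hne
  · rcases q with ⟨j, hj⟩ | ⟨⟨j, m⟩, hj, hm⟩
    · exact absurd hq hj
    · have hmem : v ∈ Set.range ((g j).updateRow m v) := ⟨m, updateRow_self⟩
      simpa [stellarBump, stellarGen, hm.ne'] using hmem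
  · obtain ⟨i, l, rfl⟩ := hv.resolve_left hne
    obtain ⟨l', hl'⟩ := hg.row_mem_range hq
    rw [← hl'] at hne ⊢
    rcases q with ⟨j, hj⟩ | ⟨⟨j, m⟩, hj, hm⟩
    · have hmem : g j l' ∈ Set.range (g j) := ⟨l', rfl⟩
      have hne' : g j l' ≠ γ := hne
      simpa [stellarBump, stellarGen, stellarParent, hne'] using hmem
    · have hne' : g j l' ≠ γ := hne
      have hrange := row_mem_range_updateRow_iff (hg.det_ne_zero j) hne' (k := m)
      rcases eq_or_ne l' m with rfl | hlm
      · simpa [stellarBump, stellarGen, stellarParent, hne', coords_row (hg.det_ne_zero j),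
          hm.le, hm.ne'] using hrange
      · simpa [stellarBump, stellarGen, stellarParent, hne', coords_row (hg.det_ne_zero j), hlm,
          hlm.symm] using hrange

theorem IsConvexFan.stellarGen [Finite ι] (hg : IsConvexFan g) (hγ : γ ≠ 0) :
    IsConvexFan (stellarGen g γ) := by
  refine hg.of_subdivision (stellarGen_det_ne_zero hg.det_ne_zero) (stellarGen_cover hg hγ)
    (coords_stellarParent_nonneg hg.det_ne_zero) (z := stellarBump g γ) fun p q k hq => ?_
  rw [stellarBump_eq hg.det_ne_zero p]
  exact stellarBump_le_iff hg q (stellarGen_eq_or_exists_row p k) hq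

end Stellar

section Termination

open Finset Classical in
theorem isDershowitzMannaLT_stellarGen {α : Type*} [Preorder α] [Fintype ι]
    {g : ι → Matrix (Fin n) (Fin n) ℤ} {γ : Fin n → ℤ}
    (m : Matrix (Fin n) (Fin n) ℤ → α) {i : ι} (hi : 0 ≤ coords (g i) (latticeHom n γ))
    (h : ∀ j k, 0 ≤ coords (g j) (latticeHom n γ) → 0 < coords (g j) (latticeHom n γ) k →
      m ((g j).updateRow k γ) < m (g j)) :
    Multiset.IsDershowitzMannaLT (univ.val.map fun p => m (stellarGen g γ p))
      (univ.val.map fun j => m (g j)) := by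
  refine ⟨univ.val.map fun j : {j // ¬ 0 ≤ coords (g j) (latticeHom n γ)} => m (g j),
    univ.val.map fun p : {p : ι × Fin n // 0 ≤ coords (g p.1) (latticeHom n γ) ∧
      0 < coords (g p.1) (latticeHom n γ) p.2} => m ((g p.1.1).updateRow p.1.2 γ),
    univ.val.map fun j : {j // 0 ≤ coords (g j) (latticeHom n γ)} => m (g j), ?_, ?_, ?_, ?_⟩
  · exact ne_of_mem_of_not_mem' (Multiset.mem_map_of_mem _ (mem_univ ⟨i, hi⟩))
      (Multiset.notMem_zero _)
  · rw [← univ_disjSum_univ]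
    simp [Finset.disjSum, Multiset.disjSum, stellarGen, Function.comp_def]
  · rw [← Multiset.map_univ_val_equiv (Equiv.sumCompl fun j => 0 ≤ coords (g j) (latticeHom n γ)),
      ← univ_disjSum_univ]
    simp [Finset.disjSum, Multiset.disjSum, Function.comp_def, add_comm]
  · simp only [Multiset.mem_map, mem_val, mem_univ, true_and]
    rintro _ ⟨⟨⟨j, k⟩, hj, hk⟩, rfl⟩
    exact ⟨_, ⟨⟨j, hj⟩, rfl⟩, h j k hj hk⟩

theorem exists_finer_forall_not {α : Type*} [Preorder α] [WellFoundedLT α]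
    (bad : Matrix (Fin n) (Fin n) ℤ → Prop) (m : Matrix (Fin n) (Fin n) ℤ → α)
    (step : ∀ {ι : Type u} (g : ι → Matrix (Fin n) (Fin n) ℤ), IsConvexFan g →
      ∀ i, bad (g i) → ∃ γ, γ ≠ 0 ∧ 0 ≤ coords (g i) (latticeHom n γ) ∧
        ∀ j k, 0 ≤ coords (g j) (latticeHom n γ) → 0 < coords (g j) (latticeHom n γ) k →
          m ((g j).updateRow k γ) < m (g j))
    {ι : Type u} [Finite ι] {g : ι → Matrix (Fin n) (Fin n) ℤ} (hg : IsConvexFan g) :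
    ∃ (ι' : Type u) (_ : Finite ι') (g' : ι' → Matrix (Fin n) (Fin n) ℤ),
      IsConvexFan g' ∧ Finer g' g ∧ ∀ i, ¬ bad (g' i) := by
  classical
  cases nonempty_fintype ι
  have hwf := Multiset.wellFounded_isDershowitzMannaLT (α := α)
  induction hM : Finset.univ.val.map fun j => m (g j) using hwf.induction generalizing ι with
  | h M ih =>
    by_cases hbad : ∃ i, bad (g i)
    · obtain ⟨i, hi⟩ := hbad
      obtain ⟨γ, hγ, hiγ, hdec⟩ := step g hg i hi
      obtain ⟨ι', hfin, g', hg', hfiner, hgood⟩ := ih _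
        (hM ▸ isDershowitzMannaLT_stellarGen m hiγ hdec) (hg.stellarGen hγ) _ rfl
      exact ⟨ι', hfin, g', hg', hfiner.trans (stellarGen_det_ne_zero hg.det_ne_zero)
        (stellarGen_finer hg.det_ne_zero), hgood⟩
    · push Not at hbad
      exact ⟨ι, inferInstance, g, hg, Finer.refl hg.det_ne_zero, hbad⟩

end Termination

section Unimodular

variable {A : Matrix (Fin n) (Fin n) ℤ}

theorem natAbs_det_updateRow_lt (hA : A.det ≠ 0) {k : Fin n} {γ : Fin n → ℤ}
    (h0 : 0 ≤ coords A (latticeHom n γ) k) (h1 : coords A (latticeHom n γ) k < 1) :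
    (A.updateRow k γ).det.natAbs < A.det.natAbs := by
  zify
  have h : |((A.updateRow k γ).det : ℝ)| < |(A.det : ℝ)| := by
    rw [det_updateRow_eq hA, abs_mul, abs_of_nonneg h0]
    exact mul_lt_of_lt_one_left (abs_pos.2 (Int.cast_ne_zero.2 hA)) h1
  exact_mod_cast h

theorem exists_coords_mem_Ico (hA : A.det ≠ 0) (hA1 : A.det.natAbs ≠ 1) :
    ∃ γ : Fin n → ℤ, γ ≠ 0 ∧ ∀ k, coords A (latticeHom n γ) k ∈ Set.Ico 0 1 := by
  have hns : ¬ Function.Surjective fun v : Fin n → ℤ => v ᵥ* A := by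
    rwa [vecMul_surjective_iff_isUnit, isUnit_iff_isUnit_det, Int.isUnit_iff_natAbs_eq]
  simp only [Function.Surjective, not_forall, not_exists] at hns
  obtain ⟨z, hz⟩ := hns
  let f : Fin n → ℤ := fun k => ⌊coords A (latticeHom n z) k⌋
  refine ⟨z - f ᵥ* A, fun h => hz f (sub_eq_zero.1 h).symm, fun k => ?_⟩
  rw [map_sub, map_sub, coords_latticeHom_vecMul hA]
  exact ⟨Int.fract_nonneg _, Int.fract_lt_one _⟩

theorem exists_decreasing_natAbs_det (g : ι → Matrix (Fin n) (Fin n) ℤ) (hg : IsConvexFan g)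
    (i : ι) (hi : (g i).det.natAbs ≠ 1) :
    ∃ γ, γ ≠ 0 ∧ 0 ≤ coords (g i) (latticeHom n γ) ∧
      ∀ j k, 0 ≤ coords (g j) (latticeHom n γ) → 0 < coords (g j) (latticeHom n γ) k →
        ((g j).updateRow k γ).det.natAbs < (g j).det.natAbs := by
  obtain ⟨γ, hγ, hIco⟩ := exists_coords_mem_Ico (hg.det_ne_zero i) hi
  have hiγ : 0 ≤ coords (g i) (latticeHom n γ) := fun k => (hIco k).1
  refine ⟨γ, hγ, hiγ, fun j k hj hk => ?_⟩
  obtain ⟨l, -, hl⟩ := hg.exists_row hj hiγ hk.ne'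
  exact natAbs_det_updateRow_lt (hg.det_ne_zero j) hk.le (hl ▸ (hIco l).2)

theorem exists_finer_natAbs_det_eq_one [Finite ι] {g : ι → Matrix (Fin n) (Fin n) ℤ}
    (hg : IsConvexFan g) :
    ∃ (ι' : Type u) (_ : Finite ι') (g' : ι' → Matrix (Fin n) (Fin n) ℤ),
      IsConvexFan g' ∧ Finer g' g ∧ ∀ i, (g' i).det.natAbs = 1 := by
  obtain ⟨ι', hfin, g', hg', hfiner, hgood⟩ := exists_finer_forall_not
    (fun A => A.det.natAbs ≠ 1) (fun A => A.det.natAbs)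
    exists_decreasing_natAbs_det hg
  exact ⟨ι', hfin, g', hg', hfiner, fun i => not_not.1 (hgood i)⟩

end Unimodular

section Hyperplane

variable {A B : Matrix (Fin n) (Fin n) ℤ} {f : Module.Dual ℝ (Fin n → ℝ)}

/-- The cone spanned by the rows of `A` lies on one side of the hyperplane `f = 0`. -/
def OneSided (f : Module.Dual ℝ (Fin n → ℝ)) (A : Matrix (Fin n) (Fin n) ℤ) : Prop :=
  (∀ k, 0 ≤ f (latticeHom n (A k))) ∨ ∀ k, f (latticeHom n (A k)) ≤ 0

/-- A linear functional is rational if a positive multiple of it has integer values on the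
lattice. -/
def IsRationalFunctional (f : Module.Dual ℝ (Fin n → ℝ)) : Prop :=
  ∃ c : ℝ, 0 < c ∧ ∀ v, ∃ z : ℤ, c * f (latticeHom n v) = z

theorem isRationalFunctional_coords (hA : A.det ≠ 0) (k : Fin n) :
    IsRationalFunctional (LinearMap.proj k ∘ₗ coords A) := by
  refine ⟨|(A.det : ℝ)|, abs_pos.2 (Int.cast_ne_zero.2 hA), fun v => ?_⟩
  rcases abs_choice (A.det : ℝ) with h | h
  · refine ⟨(A.updateRow k v).det, ?_⟩
    rw [h, det_updateRow_eq hA, mul_comm]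
    rfl
  · refine ⟨-(A.updateRow k v).det, ?_⟩
    rw [h, Int.cast_neg, det_updateRow_eq hA, neg_mul, mul_comm]
    rfl

theorem OneSided.of_coords_nonneg (hA : A.det ≠ 0) (h : OneSided f A)
    (hB : ∀ k, 0 ≤ coords A (latticeHom n (B k))) : OneSided f B := by
  refine h.imp (fun h k => ?_) fun h k => ?_ <;> rw [map_eq_sum_coords hA f]
  · exact Finset.sum_nonneg fun l _ => mul_nonneg (hB k l) (h l)
  · exact Finset.sum_nonpos fun l _ => mul_nonpos_of_nonneg_of_nonpos (hB k l) (h l)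

theorem exists_mem_hyperplane_of_not_oneSided (hA : A.det ≠ 0) (hf : IsRationalFunctional f)
    (h : ¬ OneSided f A) :
    ∃ γ, γ ≠ 0 ∧ f (latticeHom n γ) = 0 ∧ 0 ≤ coords A (latticeHom n γ) ∧
      ∀ k, coords A (latticeHom n γ) k ≠ 0 → f (latticeHom n (A k)) ≠ 0 := by
  simp only [OneSided, not_or, not_forall, not_le] at h
  obtain ⟨⟨a, ha⟩, b, hb⟩ := h
  obtain ⟨r, hr, hinteger⟩ := hf
  obtain ⟨za, hza⟩ := hinteger (A a)
  obtain ⟨zb, hzb⟩ := hinteger (A b)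
  have hza0 : (za : ℝ) < 0 := hza ▸ mul_neg_of_pos_of_neg hr ha
  have hzb0 : (0 : ℝ) < zb := hzb ▸ mul_pos hr hb
  have hab : a ≠ b := by
    rintro rfl
    exact lt_asymm ha hb
  set c : Fin n → ℤ := Pi.single a zb + Pi.single b (-za) with hc
  have hcoords : coords A (latticeHom n (c ᵥ* A)) =
      Pi.single a (zb : ℝ) + Pi.single b (-za : ℝ) := by
    rw [coords_latticeHom_vecMul hA]
    funext k
    simp [latticeHom_apply, hc, Pi.single_apply, apply_ite (Int.cast : ℤ → ℝ)]
  refine ⟨c ᵥ* A, fun h => ?_, ?_, ?_, fun k hk => ?_⟩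
  · rw [h, map_zero, map_zero] at hcoords
    simpa [hab, hzb0.ne] using congrFun hcoords a
  · rw [map_eq_sum_coords hA f, hcoords]
    simp only [Pi.add_apply, Pi.single_apply, add_mul, ite_mul, zero_mul, Finset.sum_add_distrib,
      Finset.sum_ite_eq', Finset.mem_univ, if_true]
    rw [← hza, ← hzb]
    ring
  · rw [hcoords]
    exact add_nonneg (Pi.single_nonneg.2 hzb0.le) (Pi.single_nonneg.2 (neg_pos.2 hza0).le)
  · rcases eq_or_ne k a with rfl | hka
    · exact ha.ne
    rcases eq_or_ne k b with rfl | hkb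
    · exact hb.ne'
    · simp [hcoords, hka, hkb] at hk

open Classical in
theorem card_updateRow_lt {γ : Fin n → ℤ} (hγ : f (latticeHom n γ) = 0) {k : Fin n}
    (hk : f (latticeHom n (A k)) ≠ 0) :
    Finset.card {l | f (latticeHom n (A.updateRow k γ l)) ≠ 0} <
      Finset.card {l | f (latticeHom n (A l)) ≠ 0} := by
  refine Finset.card_lt_card (Finset.ssubset_iff_of_subset (fun m hm => ?_) |>.2
    ⟨k, by simpa using hk, by simp [hγ]⟩)
  rcases eq_or_ne m k with rfl | hmk
  · simpa using hk
  · simpa [updateRow_ne hmk] using hm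

open Classical in
theorem exists_decreasing_card (hf : IsRationalFunctional f) (g : ι → Matrix (Fin n) (Fin n) ℤ)
    (hg : IsConvexFan g) (i : ι) (hi : ¬ OneSided f (g i)) :
    ∃ γ, γ ≠ 0 ∧ 0 ≤ coords (g i) (latticeHom n γ) ∧
      ∀ j k, 0 ≤ coords (g j) (latticeHom n γ) → 0 < coords (g j) (latticeHom n γ) k →
        Finset.card {l | f (latticeHom n ((g j).updateRow k γ l)) ≠ 0} <
          Finset.card {l | f (latticeHom n (g j l)) ≠ 0} := by
  obtain ⟨γ, hγ, hfγ, hiγ, hne⟩ := exists_mem_hyperplane_of_not_oneSided (hg.det_ne_zero i) hf hi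
  refine ⟨γ, hγ, hiγ, fun j k hj hk => card_updateRow_lt hfγ ?_⟩
  obtain ⟨l, hl, hl'⟩ := hg.exists_row hj hiγ hk.ne'
  exact hl ▸ hne l (hl' ▸ hk.ne')

open Classical in
theorem exists_finer_oneSided (hf : IsRationalFunctional f) [Finite ι]
    {g : ι → Matrix (Fin n) (Fin n) ℤ} (hg : IsConvexFan g) :
    ∃ (ι' : Type u) (_ : Finite ι') (g' : ι' → Matrix (Fin n) (Fin n) ℤ),
      IsConvexFan g' ∧ Finer g' g ∧ ∀ i, OneSided f (g' i) := by
  obtain ⟨ι', hfin, g', hg', hfiner, hgood⟩ := exists_finer_forall_not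
    (fun A => ¬ OneSided f A) (fun A => Finset.card {k | f (latticeHom n (A k)) ≠ 0})
    (exists_decreasing_card hf) hg
  exact ⟨ι', hfin, g', hg', hfiner, fun i => not_not.1 (hgood i)⟩

theorem exists_finer_forall_oneSided [Finite ι] {g : ι → Matrix (Fin n) (Fin n) ℤ}
    (hg : IsConvexFan g) {U : Set (Module.Dual ℝ (Fin n → ℝ))} (hfin : U.Finite)
    (hU : ∀ f ∈ U, IsRationalFunctional f) :
    ∃ (ι' : Type u) (_ : Finite ι') (g' : ι' → Matrix (Fin n) (Fin n) ℤ),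
      IsConvexFan g' ∧ Finer g' g ∧ ∀ f ∈ U, ∀ i, OneSided f (g' i) := by
  induction U, hfin using Set.Finite.induction_on with
  | empty => exact ⟨ι, inferInstance, g, hg, Finer.refl hg.det_ne_zero, by simp⟩
  | @insert f U _ _ ih =>
    obtain ⟨ι', _, g', hg', hfiner, hside⟩ := ih fun f hf => hU f (Set.mem_insert_of_mem _ hf)
    obtain ⟨ι'', hfin, g'', hg'', hfiner', hside'⟩ :=
      exists_finer_oneSided (hU f (Set.mem_insert _ _)) hg'
    refine ⟨ι'', hfin, g'', hg'', hfiner'.trans hg'.det_ne_zero hfiner, ?_⟩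
    rintro _ (rfl | hf) i
    · exact hside' i
    · obtain ⟨j, hj⟩ := hfiner' i
      exact (hside _ hf j).of_coords_nonneg (hg'.det_ne_zero j) hj

end Hyperplane

section Orthants

/-- The generators of the orthant with sign vector `s`. -/
def orthantGen (s : Fin n → ℤˣ) : Matrix (Fin n) (Fin n) ℤ := diagonal fun k => (s k : ℤ)

theorem orthantGen_row (s : Fin n → ℤˣ) (k : Fin n) :
    orthantGen s k = Pi.single k (s k : ℤ) := by
  funext l
  simp only [orthantGen, diagonal_apply, Pi.single_apply, eq_comm]

theorem latticeHom_orthantGen (s : Fin n → ℤˣ) (k : Fin n) :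
    latticeHom n (orthantGen s k) = Pi.single k ((s k : ℤ) : ℝ) := by
  funext l
  simp [orthantGen_row, latticeHom_apply, Pi.single_apply, apply_ite (Int.cast : ℤ → ℝ)]

theorem orthantGen_det_ne_zero (s : Fin n → ℤˣ) : (orthantGen s).det ≠ 0 := by
  rw [orthantGen, det_diagonal]
  exact Finset.prod_ne_zero_iff.2 fun k _ => (s k).ne_zero

theorem orthantGen_cover (x : Fin n → ℝ) : ∃ s : Fin n → ℤˣ, 0 ≤ coords (orthantGen s) x := by
  classical
  let s : Fin n → ℤˣ := fun k => if 0 ≤ x k then 1 else -1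
  have hs : ∀ k, |x k| * ((s k : ℤ) : ℝ) = x k := fun k => by
    by_cases h : 0 ≤ x k
    · simp [s, h, abs_of_nonneg h]
    · simp [s, h, abs_of_neg (not_le.1 h)]
  have hx : coords (orthantGen s) x = fun k => |x k| := by
    refine coords_eq_of_sum_eq (orthantGen_det_ne_zero s) ?_
    funext l
    simp [latticeHom_orthantGen, Pi.single_apply, hs]
  exact ⟨s, hx ▸ fun k => abs_nonneg _⟩

-- The support function is the `ℓ¹` norm.
theorem isSupport_orthantGen : IsSupport (orthantGen (n := n)) fun s =>
    dotProductEquiv ℝ (Fin n) fun k => ((s k : ℤ) : ℝ) := by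
  have hrange : ∀ (s t : Fin n → ℤˣ) k, orthantGen s k ∈ Set.range (orthantGen t) ↔ t k = s k := by
    refine fun s t k => ⟨?_, fun h => ⟨k, by rw [orthantGen_row, orthantGen_row, h]⟩⟩
    rintro ⟨l, hl⟩
    have hk := congrFun hl k
    rcases eq_or_ne l k with rfl | hne
    · simpa [orthantGen_row, Units.val_inj] using hk
    · simp only [orthantGen_row, Pi.single_eq_same, Pi.single_eq_of_ne' hne] at hk
      exact absurd hk.symm (s k).ne_zero
  refine ⟨fun s t k => ?_, fun s t k => ?_⟩
  all_goals
    simp only [hrange, latticeHom_orthantGen, dotProductEquiv_apply_apply, dotProduct_single]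
    rcases Int.units_eq_one_or (s k) with hs | hs <;>
      rcases Int.units_eq_one_or (t k) with ht | ht <;> norm_num [hs, ht]

theorem isConvexFan_orthantGen : IsConvexFan (orthantGen (n := n)) :=
  ⟨orthantGen_det_ne_zero, orthantGen_cover, _, isSupport_orthantGen⟩

end Orthants

section Caratheodory

variable {𝕜 κ M : Type*} [Field 𝕜] [LinearOrder 𝕜] [IsStrictOrderedRing 𝕜] [AddCommGroup M]
  [Module 𝕜 M]

theorem exists_ssubset_sum_eq_of_not_linearIndepOn {f : κ → M} {s : Finset κ} {c : κ → 𝕜}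
    (hc : ∀ i ∈ s, 0 < c i) (hs : ¬ LinearIndepOn 𝕜 f (s : Set κ)) :
    ∃ t ⊂ s, ∃ d : κ → 𝕜, (∀ i ∈ t, 0 < d i) ∧ ∑ i ∈ t, d i • f i = ∑ i ∈ s, c i • f i := by
  classical
  obtain ⟨e, he, i₀, hi₀s, hi₀⟩ : ∃ e : κ → 𝕜, ∑ i ∈ s, e i • f i = 0 ∧ ∃ i ∈ s, 0 < e i := by
    rw [linearIndepOn_finset_iff] at hs
    push Not at hs
    obtain ⟨e, he, i, hi, hne⟩ := hs
    rcases lt_or_gt_of_ne hne with h | h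
    · exact ⟨-e, by simp [he], i, hi, by simpa using h⟩
    · exact ⟨e, he, i, hi, h⟩
  obtain ⟨k, hk, hmin⟩ := Finset.exists_min_image (s.filter fun i => 0 < e i)
    (fun i => c i / e i) ⟨i₀, by simp [hi₀s, hi₀]⟩
  simp only [Finset.mem_filter] at hk hmin
  let d : κ → 𝕜 := fun i => c i - c k / e k * e i
  have hd : ∀ i ∈ s, 0 ≤ d i := fun i hi => by
    rcases le_or_gt (e i) 0 with h | h
    · exact sub_nonneg.2 ((mul_nonpos_of_nonneg_of_nonpos (div_pos (hc k hk.1) hk.2).le h).trans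
        (hc i hi).le)
    · exact sub_nonneg.2 ((le_div_iff₀ h).1 (hmin i ⟨hi, h⟩))
  have hsum : ∑ i ∈ s, d i • f i = ∑ i ∈ s, c i • f i := by
    simp only [d, sub_smul, Finset.sum_sub_distrib, mul_smul, ← Finset.smul_sum, he, smul_zero,
      sub_zero]
  have hss : (s.filter fun i => 0 < d i) ⊂ s :=
    Finset.filter_ssubset.2 ⟨k, hk.1, by simp [d, div_mul_cancel₀ _ hk.2.ne']⟩
  refine ⟨_, hss, d, fun i hi => (Finset.mem_filter.1 hi).2, hsum ▸ ?_⟩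
  refine Finset.sum_subset hss.subset fun i hi hi' => ?_
  rw [(hd i hi).antisymm' (not_lt.1 fun h => hi' (Finset.mem_filter.2 ⟨hi, h⟩)), zero_smul]

theorem exists_linearIndepOn_sum_eq (f : κ → M) (s : Finset κ) (c : κ → 𝕜)
    (hc : ∀ i ∈ s, 0 < c i) :
    ∃ t ⊆ s, ∃ d : κ → 𝕜, (∀ i ∈ t, 0 < d i) ∧ LinearIndepOn 𝕜 f (t : Set κ) ∧
      ∑ i ∈ t, d i • f i = ∑ i ∈ s, c i • f i := by
  induction s using Finset.strongInduction generalizing c with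
  | H s ih =>
    by_cases hs : LinearIndepOn 𝕜 f (s : Set κ)
    · exact ⟨s, subset_rfl, c, hc, hs, rfl⟩
    obtain ⟨t, hts, d, hd, hsum⟩ := exists_ssubset_sum_eq_of_not_linearIndepOn hc hs
    obtain ⟨u, hut, e, he, hu, hsum'⟩ := ih t hts d hd
    exact ⟨u, hut.trans hts.subset, e, he, hu, hsum'.trans hsum⟩

end Caratheodory

section Refinement

variable {A B : Matrix (Fin n) (Fin n) ℤ}

theorem span_image_latticeHom_single :
    Submodule.span ℝ (latticeHom n '' Set.range fun k : Fin n => Pi.single k (1 : ℤ)) = ⊤ := by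
  have h : latticeHom n '' (Set.range fun k : Fin n => Pi.single k (1 : ℤ)) =
      Set.range (Pi.basisFun ℝ (Fin n)) := by
    rw [← Set.range_comp]
    congr 1
    funext k l
    simp [latticeHom_apply, Pi.single_apply]
  rw [h, Module.Basis.span_eq]

theorem exists_matrix_range_superset {t : Set (Fin n → ℤ)}
    (ht : LinearIndepOn ℝ (latticeHom n) t) :
    ∃ B : Matrix (Fin n) (Fin n) ℤ, B.det ≠ 0 ∧ t ⊆ Set.range B ∧
      Set.range B ⊆ t ∪ Set.range fun k => Pi.single k 1 := by
  obtain ⟨b, hbt, htb, hspan, hbli⟩ := exists_linearIndepOn_extension (K := ℝ)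
    (t := t ∪ Set.range fun k : Fin n => Pi.single k (1 : ℤ)) ht Set.subset_union_left
  have htop : ⊤ ≤ Submodule.span ℝ (Set.range fun v : b => latticeHom n v) := by
    rw [← span_image_latticeHom_single, Submodule.span_le, ← Set.image_eq_range]
    exact (Set.image_mono Set.subset_union_right).trans hspan
  let basis := Module.Basis.mk hbli htop
  have : Fintype b := FiniteDimensional.fintypeBasisIndex basis
  have hcard : Fintype.card b = n := by
    rw [← Module.finrank_eq_card_basis basis, Module.finrank_fin_fun]
  let e : Fin n ≃ b := (Fintype.equivFinOfCardEq hcard).symm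
  let B : Matrix (Fin n) (Fin n) ℤ := fun k => e k
  have hrange : Set.range B = b := (e.surjective.range_comp Subtype.val).trans Subtype.range_coe
  refine ⟨B, fun h => ?_, htb.trans hrange.symm.subset, hrange.trans_subset hbt⟩
  have hli : LinearIndependent ℝ (B.map (Int.cast : ℤ → ℝ)).row := hbli.comp e e.injective
  rw [linearIndependent_rows_iff_isUnit, isUnit_iff_isUnit_det, det_map_intCast] at hli
  exact hli.ne_zero (by exact_mod_cast h)

theorem coords_sum_of_subset_range (hB : B.det ≠ 0) {t : Finset (Fin n → ℤ)}
    (ht : ↑t ⊆ Set.range B) (d : (Fin n → ℤ) → ℝ) :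
    coords B (∑ v ∈ t, d v • latticeHom n v) = fun k => if B k ∈ t then d (B k) else 0 := by
  refine coords_eq_of_sum_eq hB ?_
  have hinter : Finset.univ.image B ∩ t = t :=
    Finset.inter_eq_right.2 fun v hv => mem_image_univ_iff_mem_range.2 (ht hv)
  conv_rhs => rw [← hinter, ← Finset.sum_ite_mem, Finset.sum_image (row_injective hB).injOn]
  simp only [ite_smul, zero_smul]

theorem exists_matrix_of_mem_hull {s : Set (Fin n → ℤ)} {x : Fin n → ℝ}
    (hx : x ∈ PointedCone.hull ℝ (latticeHom n '' s)) :
    ∃ B : Matrix (Fin n) (Fin n) ℤ, B.det ≠ 0 ∧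
      Set.range B ⊆ s ∪ Set.range (fun k => Pi.single k 1) ∧
      0 ≤ coords B x ∧ ∀ k, coords B x k ≠ 0 → B k ∈ s := by
  obtain ⟨c, hcs, hc⟩ := (Finsupp.mem_span_image_iff_linearCombination _).1 hx
  obtain ⟨t, htc, d, hd, hli, hsum⟩ := exists_linearIndepOn_sum_eq (latticeHom n)
    c.support (fun v => (c v : ℝ)) fun v hv =>
      (c v).2.lt_of_ne fun h => Finsupp.mem_support_iff.1 hv (Subtype.ext h.symm)
  have hts : (t : Set (Fin n → ℤ)) ⊆ s := (Finset.coe_subset.2 htc).trans hcs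
  obtain ⟨B, hB, htB, hBt⟩ := exists_matrix_range_superset hli
  have hcoords : coords B x = fun k => if B k ∈ t then d (B k) else 0 := by
    rw [← coords_sum_of_subset_range hB htB, hsum, ← hc]
    rfl
  refine ⟨B, hB, hBt.trans (Set.union_subset_union_left _ hts), ?_, fun k hk => ?_⟩
  · rw [hcoords]
    intro k
    change 0 ≤ if B k ∈ t then d (B k) else 0
    split_ifs with hk
    exacts [(hd _ hk).le, le_rfl]
  · rw [hcoords] at hk
    exact hts (of_not_not fun h => hk (if_neg h))

theorem mem_hull_of_coords (hB : B.det ≠ 0) {s : Set (Fin n → ℝ)} {x : Fin n → ℝ}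
    (hx : 0 ≤ coords B x) (h : ∀ k, coords B x k ≠ 0 → latticeHom n (B k) ∈ s) :
    x ∈ PointedCone.hull ℝ s := by
  rw [← sum_coords hB x]
  refine Submodule.sum_mem _ fun k _ => ?_
  by_cases hk : coords B x k = 0
  · rw [hk, zero_smul]
    exact zero_mem _
  · exact PointedCone.smul_mem _ (hx k) (PointedCone.subset_hull (h k hk))

theorem coords_sum_ne_zero_of_oneSided (hA : A.det ≠ 0) (hB : B.det ≠ 0) {k : Fin n}
    (h : OneSided (LinearMap.proj k ∘ₗ coords B) A) :
    coords B (∑ l, latticeHom n (A l)) k ≠ 0 := by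
  intro hsum
  rw [map_sum, Finset.sum_apply] at hsum
  have hrow : ∀ l, coords B (latticeHom n (A l)) k = 0 := fun l => by
    rcases h with h | h
    · exact (Finset.sum_eq_zero_iff_of_nonneg fun l _ => h l).1 hsum l (Finset.mem_univ l)
    · exact (Finset.sum_eq_zero_iff_of_nonpos fun l _ => h l).1 hsum l (Finset.mem_univ l)
  have hzero : coords B (latticeHom n (B k)) k = 0 := by
    rw [← sum_coords hA (latticeHom n (B k)), map_sum, Finset.sum_apply]
    exact Finset.sum_eq_zero fun l _ => by rw [map_smul, Pi.smul_apply, hrow, smul_zero]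
  simp [coords_row hB] at hzero

theorem coords_row_nonneg_of_oneSided (hA : A.det ≠ 0) (hB : B.det ≠ 0) {k : Fin n}
    (h : OneSided (LinearMap.proj k ∘ₗ coords B) A)
    (hx : 0 ≤ coords B (∑ l, latticeHom n (A l)) k) (l : Fin n) :
    0 ≤ coords B (latticeHom n (A l)) k := by
  have hne := coords_sum_ne_zero_of_oneSided hA hB h
  rcases h with h | h
  · exact h l
  · refine absurd (hx.antisymm' ?_) hne
    rw [map_sum, Finset.sum_apply]
    exact Finset.sum_nonpos fun l _ => h l

theorem exists_isConvexFan_refining (S : PolyhedralFan n) (hrat : S.IsRational)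
    (hcomplete : S.IsComplete) :
    ∃ (ι : Type) (_ : Finite ι) (g : ι → Matrix (Fin n) (Fin n) ℤ),
      IsConvexFan g ∧ ∀ i, ∃ C ∈ S.cones, ∀ k, latticeHom n (g i k) ∈ C := by
  choose s hs using hrat
  let G : Set (Fin n → ℤ) :=
    (⋃ C : S.cones, (s C.1 C.2 : Set (Fin n → ℤ))) ∪ Set.range fun k => Pi.single k 1
  have : Finite S.cones := S.finite
  have hG : G.Finite :=
    (Set.finite_iUnion fun C : S.cones => (s C.1 C.2).finite_toSet).union (Set.finite_range _)
  let 𝓑 : Set (Matrix (Fin n) (Fin n) ℤ) := {B | B.det ≠ 0 ∧ ∀ k, B k ∈ G}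
  have h𝓑 : 𝓑.Finite := (Set.Finite.pi' fun _ => hG).subset fun B hB => hB.2
  let U : Set (Module.Dual ℝ (Fin n → ℝ)) :=
    ⋃ k, (fun B => LinearMap.proj k ∘ₗ coords B) '' 𝓑
  have hU : ∀ f ∈ U, IsRationalFunctional f := fun f hf => by
    obtain ⟨k, B, hB, rfl⟩ := Set.mem_iUnion.1 hf
    exact isRationalFunctional_coords hB.1 k
  obtain ⟨ι, hfin, g, hg, -, hside⟩ := exists_finer_forall_oneSided isConvexFan_orthantGen
    (Set.finite_iUnion fun k => h𝓑.image _) hU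
  refine ⟨ι, hfin, g, hg, fun i => ?_⟩
  obtain ⟨C, hC, hx⟩ := hcomplete (∑ k, latticeHom n (g i k))
  rw [hs C hC] at hx
  obtain ⟨B, hB, hBG, hB0, hBs⟩ := exists_matrix_of_mem_hull hx
  have hsideB : ∀ k, OneSided (LinearMap.proj k ∘ₗ coords B) (g i) := fun k =>
    hside _ (Set.mem_iUnion.2 ⟨k, B, ⟨hB, fun l => (hBG ⟨l, rfl⟩).imp
      (fun hl => Set.mem_iUnion.2 ⟨⟨C, hC⟩, hl⟩) id⟩, rfl⟩) i
  refine ⟨C, hC, fun l => hs C hC ▸ mem_hull_of_coords hB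
    (fun k => coords_row_nonneg_of_oneSided (hg.det_ne_zero i) hB (hsideB k) (hB0 k) l)
    fun k _ => Set.mem_image_of_mem _ (hBs k ?_)⟩
  exact coords_sum_ne_zero_of_oneSided (hg.det_ne_zero i) hB (hsideB k)

theorem range_eq_of_subset (hA : A.det ≠ 0) (hB : B.det ≠ 0) (h : Set.range A ⊆ Set.range B) :
    Set.range A = Set.range B := by
  have hcard : ∀ v : Fin n → Fin n → ℤ, Function.Injective v → (Set.range v).ncard = n :=
    fun v hv => by
      rw [← Set.image_univ, Set.ncard_image_of_injective _ hv, Set.ncard_univ,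
        Nat.card_eq_fintype_card, Fintype.card_fin]
  exact Set.eq_of_subset_of_ncard_le h
    (by rw [hcard _ (row_injective hA), hcard _ (row_injective hB)]) (Set.finite_range _)

theorem IsConvexFan.exists_range_injective [Finite ι] {g : ι → Matrix (Fin n) (Fin n) ℤ}
    (hg : IsConvexFan g) :
    ∃ (ι' : Type) (_ : Finite ι') (f : ι' → ι), IsConvexFan (fun i => g (f i)) ∧
      ∀ i j, Set.range (g (f i)) ⊆ Set.range (g (f j)) → i = j := by
  let r : ι → Set (Fin n → ℤ) := fun i => Set.range (g i)
  obtain ⟨y, hy⟩ := hg.exists_isSupport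
  refine ⟨Set.range r, inferInstance, Set.rangeSplitting r, ⟨fun i => hg.det_ne_zero _, fun x => ?_,
    _, fun i j => hy.le _ _, fun i j => hy.eq_iff _ _⟩, fun i j h => ?_⟩
  · obtain ⟨i, hi⟩ := hg.cover x
    refine ⟨⟨r i, i, rfl⟩, coords_nonneg_of_support (hg.det_ne_zero i) (hg.det_ne_zero _) hi
      fun k _ => ?_⟩
    exact (Set.apply_rangeSplitting r ⟨r i, i, rfl⟩).superset (Set.mem_range_self k)
  · have heq : r (Set.rangeSplitting r i) = r (Set.rangeSplitting r j) :=
      range_eq_of_subset (hg.det_ne_zero _) (hg.det_ne_zero _) h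
    rw [Set.apply_rangeSplitting r i, Set.apply_rangeSplitting r j] at heq
    exact Subtype.ext heq

theorem exists_unimodular_refining (S : PolyhedralFan n) (hrat : S.IsRational)
    (hcomplete : S.IsComplete) :
    ∃ (ι : Type) (_ : Finite ι) (g : ι → Matrix (Fin n) (Fin n) ℤ),
      IsConvexFan g ∧ (∀ i, (g i).det.natAbs = 1) ∧
      (∀ i j, Set.range (g i) ⊆ Set.range (g j) → i = j) ∧
      ∀ i, ∃ C ∈ S.cones, ∀ k, latticeHom n (g i k) ∈ C := by
  obtain ⟨ι, _, g, hg, hS⟩ := exists_isConvexFan_refining S hrat hcomplete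
  obtain ⟨ι', _, g', hg', hfiner, hdet⟩ := exists_finer_natAbs_det_eq_one hg
  obtain ⟨ι'', hfin, f, hf, hinj⟩ := hg'.exists_range_injective
  refine ⟨ι'', hfin, _, hf, fun i => hdet _, hinj, fun i => ?_⟩
  obtain ⟨j, hj⟩ := hfiner (f i)
  obtain ⟨C, hC, hCj⟩ := hS j
  refine ⟨C, hC, fun k => ?_⟩
  rw [← sum_coords (hg.det_ne_zero j) (latticeHom n (g' (f i) k))]
  exact Submodule.sum_mem _ fun l _ => C.smul_mem (hj k l) (hCj l)

end Refinement

section Substitution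

variable {κ : Type*} {g : ι → Matrix (Fin n) (Fin n) ℤ} {P : κ → Matrix (Fin n) (Fin n) ℤ}
  {z : κ → Module.Dual ℝ (Fin n → ℝ)}

/-- The generators of the cones obtained by subdividing each cone of `g` in the way the cones of
`P` subdivide the nonnegative orthant. -/
def substGen (g : ι → Matrix (Fin n) (Fin n) ℤ) (P : κ → Matrix (Fin n) (Fin n) ℤ) (p : ι × κ) :
    Matrix (Fin n) (Fin n) ℤ :=
  P p.2 * g p.1

/-- The cones of `P` subdivide the nonnegative orthant without subdividing its proper faces, and `z`
gives the pieces of a strictly convex function for this subdivision that vanishes at the unit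
vectors. Such subdivisions of the cones of a fan fit together. -/
structure IsPattern (P : κ → Matrix (Fin n) (Fin n) ℤ) (z : κ → Module.Dual ℝ (Fin n → ℝ)) :
    Prop where
  det_ne_zero : ∀ t, (P t).det ≠ 0
  cover : ∀ x : Fin n → ℝ, 0 ≤ x → ∃ t, 0 ≤ coords (P t) x
  isSupport : IsSupport P z
  row_cases : ∀ t k, (∃ m, P t k = Pi.single m 1) ∨ ∀ m, 0 < P t k m
  map_single_nonpos : ∀ t m, z t (Pi.single m 1) ≤ 0
  map_single_eq_zero_iff : ∀ t m, z t (Pi.single m 1) = 0 ↔ Pi.single m 1 ∈ Set.range (P t)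

theorem substGen_row (p : ι × κ) (k : Fin n) : substGen g P p k = P p.2 k ᵥ* g p.1 :=
  mul_apply_eq_vecMul _ _ _

theorem coords_mul (A B : Matrix (Fin n) (Fin n) ℤ) (x : Fin n → ℝ) :
    coords (A * B) x = coords A (coords B x) := by
  have h : (A * B).map (Int.cast : ℤ → ℝ) =
      A.map (Int.cast : ℤ → ℝ) * B.map (Int.cast : ℤ → ℝ) :=
    Matrix.map_mul (f := Int.castRingHom ℝ)
  simp only [coords, vecMulLinear_apply, h, Matrix.mul_inv_rev, vecMul_vecMul]

theorem vecMul_injective_of_det_ne_zero {A : Matrix (Fin n) (Fin n) ℤ} (hA : A.det ≠ 0) :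
    Function.Injective fun v : Fin n → ℤ => v ᵥ* A := fun v w h => by
  have hvw := congrArg (fun u => coords A (latticeHom n u)) h
  simp only [coords_latticeHom_vecMul hA] at hvw
  exact latticeHom_injective hvw

theorem vecMul_mem_range_mul_iff {A B : Matrix (Fin n) (Fin n) ℤ} (hB : B.det ≠ 0)
    {v : Fin n → ℤ} : v ᵥ* B ∈ Set.range (A * B) ↔ v ∈ Set.range A :=
  exists_congr fun k => by
    rw [mul_apply_eq_vecMul]
    exact (vecMul_injective_of_det_ne_zero hB).eq_iff

theorem coords_substGen_row (hg : ∀ i, (g i).det ≠ 0) (p : ι × κ) (k : Fin n) :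
    coords (g p.1) (latticeHom n (substGen g P p k)) = latticeHom n (P p.2 k) := by
  rw [substGen_row, coords_latticeHom_vecMul (hg _)]

theorem substGen_det_ne_zero (hg : ∀ i, (g i).det ≠ 0) (hP : ∀ t, (P t).det ≠ 0) (p : ι × κ) :
    (substGen g P p).det ≠ 0 := by
  rw [substGen, det_mul]
  exact mul_ne_zero (hP _) (hg _)

theorem IsPattern.latticeHom_row_nonneg (hP : IsPattern P z) (t : κ) (k : Fin n) :
    0 ≤ latticeHom n (P t k) := fun m => by
  rw [latticeHom_apply]
  refine Int.cast_nonneg ?_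
  rcases hP.row_cases t k with ⟨r, hr⟩ | h
  · rw [hr]
    exact (Pi.single_nonneg.2 zero_le_one : (0 : Fin n → ℤ) ≤ Pi.single r 1) m
  · exact (h m).le

theorem IsPattern.latticeHom_substGen_mem (hP : IsPattern P z) {C : PointedCone ℝ (Fin n → ℝ)}
    {p : ι × κ} (h : ∀ k, latticeHom n (g p.1 k) ∈ C) (k : Fin n) :
    latticeHom n (substGen g P p k) ∈ C := by
  rw [substGen_row, latticeHom_vecMul]
  exact Submodule.sum_mem _ fun l _ => C.smul_mem (hP.latticeHom_row_nonneg p.2 k l) (h l)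

theorem latticeHom_single (m : Fin n) : latticeHom n (Pi.single m 1) = Pi.single m 1 := by
  funext l
  simp [latticeHom_apply, Pi.single_apply]

theorem IsPattern.map_coords_substGen_le (hP : IsPattern P z) (hg : IsConvexFan g)
    (hinj : ∀ i j, Set.range (g i) ⊆ Set.range (g j) → i = j) (p q : ι × κ) (k : Fin n)
    (hq : 0 ≤ coords (g q.1) (latticeHom n (substGen g P p k))) :
    z q.2 (coords (g q.1) (latticeHom n (substGen g P p k))) ≤ z p.2 (latticeHom n (P p.2 k)) ∧
      (z q.2 (coords (g q.1) (latticeHom n (substGen g P p k))) = z p.2 (latticeHom n (P p.2 k)) ↔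
        substGen g P p k ∈ Set.range (substGen g P q)) := by
  obtain ⟨i, t⟩ := p
  obtain ⟨j, s⟩ := q
  by_cases hij : i = j
  · subst hij
    rw [coords_substGen_row hg.det_ne_zero (i, t), substGen_row, substGen,
      vecMul_mem_range_mul_iff (hg.det_ne_zero i)]
    exact ⟨hP.isSupport.le t s k, hP.isSupport.eq_iff t s k⟩
  rcases hP.row_cases t k with ⟨m, hm⟩ | hpos
  · have hrow : substGen g P (i, t) k = g i m := by
      rw [substGen_row, hm, single_one_vecMul]
      rfl
    rw [hrow] at hq ⊢
    obtain ⟨r, hr⟩ := hg.row_mem_range hq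
    have hvecMul : g i m = Pi.single r 1 ᵥ* g j := by
      rw [← hr, single_one_vecMul]
      rfl
    have hcorner : z t (Pi.single m 1) = 0 := (hP.map_single_eq_zero_iff t m).2 ⟨k, hm⟩
    rw [hvecMul, coords_latticeHom_vecMul (hg.det_ne_zero j), hm, latticeHom_single,
      latticeHom_single, hcorner, substGen, vecMul_mem_range_mul_iff (hg.det_ne_zero j)]
    exact ⟨hP.map_single_nonpos s r, hP.map_single_eq_zero_iff s r⟩
  · refine absurd (hinj i j ?_) hij
    rintro _ ⟨m, rfl⟩
    have hcoords := coords_substGen_row (P := P) hg.det_ne_zero (i, t) k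
    obtain ⟨l, hl, -⟩ := hg.exists_row (hcoords.symm ▸ hP.latticeHom_row_nonneg t k) hq (k := m) (by
      rw [hcoords, latticeHom_apply]
      exact_mod_cast (hpos m).ne')
    exact ⟨l, hl⟩

theorem IsConvexFan.substGen [Finite ι] [Finite κ] (hg : IsConvexFan g)
    (hinj : ∀ i j, Set.range (g i) ⊆ Set.range (g j) → i = j) (hP : IsPattern P z) :
    IsConvexFan (substGen g P) := by
  refine hg.of_subdivision (π := Prod.fst) (z := fun p => z p.2 ∘ₗ coords (g p.1))
    (substGen_det_ne_zero hg.det_ne_zero hP.det_ne_zero) (fun x => ?_) (fun p k => ?_)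
    fun p q k hq => ?_
  · obtain ⟨i, hi⟩ := hg.cover x
    obtain ⟨t, ht⟩ := hP.cover _ hi
    exact ⟨(i, t), (coords_mul (P t) (g i) x).symm ▸ ht⟩
  · rw [coords_substGen_row hg.det_ne_zero]
    exact hP.latticeHom_row_nonneg _ _
  · simpa only [LinearMap.comp_apply, coords_substGen_row hg.det_ne_zero p] using
      hP.map_coords_substGen_le hg hinj p q k hq

end Substitution

section Pattern

/-- The rays of the pattern: those of the nonnegative octant and ten interior ones. -/
def patternVertex : Fin 13 → Fin 3 → ℤ :=
  ![![1, 0, 0], ![0, 1, 0], ![0, 0, 1], ![1, 2, 2], ![2, 1, 2], ![2, 2, 1], ![1, 1, 1],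
    ![2, 1, 1], ![1, 2, 1], ![1, 1, 2], ![3, 2, 2], ![2, 3, 2], ![2, 2, 3]]

/-- The maximal cones of the pattern, given by the indices of their rays. -/
def patternTriangle : Fin 21 → Fin 3 → Fin 13 :=
  ![![1, 2, 3], ![6, 4, 5], ![0, 7, 5], ![0, 4, 7], ![7, 10, 5], ![7, 4, 10], ![4, 5, 10],
    ![2, 0, 4], ![6, 5, 3], ![1, 8, 3], ![1, 5, 8], ![8, 11, 3], ![8, 5, 11], ![5, 3, 11],
    ![0, 1, 5], ![6, 3, 4], ![2, 9, 4], ![2, 3, 9], ![9, 12, 4], ![9, 3, 12], ![3, 4, 12]]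

/-- The values of a strictly convex support function of the pattern at its rays. -/
def patternHeight : Fin 13 → ℤ :=
  ![0, 0, 0, -33, -33, -33, -20, -23, -23, -23, -45, -45, -45]

/-- The generators of a maximal cone of the pattern. -/
def patternGen (t : Fin 21) : Matrix (Fin 3) (Fin 3) ℤ :=
  fun k => patternVertex (patternTriangle t k)

/-- The inverse of `patternGen t`, a matrix of determinant `±1`. Its columns are the inner facet
normals of the cone. -/
def patternDual (t : Fin 21) : Matrix (Fin 3) (Fin 3) ℤ :=
  (patternGen t).det • (patternGen t).adjugate

/-- The linear functional that agrees with the support function of the pattern on a maximal cone. -/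
def patternFunctional (t : Fin 21) : Fin 3 → ℤ :=
  patternDual t *ᵥ fun k => patternHeight (patternTriangle t k)

theorem patternGen_det_mul_self : ∀ t, (patternGen t).det * (patternGen t).det = 1 := by
  decide +kernel

theorem patternVertex_injective : Function.Injective patternVertex := by
  have h : ∀ v w, patternVertex v = patternVertex w → v = w := by decide +kernel
  exact h

theorem patternVertex_cases :
    ∀ w, (∃ m, patternVertex w = Pi.single m 1) ∨ ∀ m, 0 < patternVertex w m := by
  decide +kernel

theorem patternFunctional_dotProduct_patternVertex : ∀ t w,
    patternFunctional t ⬝ᵥ patternVertex w ≤ patternHeight w ∧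
      (patternFunctional t ⬝ᵥ patternVertex w = patternHeight w ↔
        ∃ k, patternTriangle t k = w) := by
  decide +kernel

-- A wall of the pattern lies in the boundary of the octant, or else it separates `t` from some `s`.
theorem patternDual_cases : ∀ t k, (∀ m, 0 ≤ patternDual t m k) ∨
    ∃ s, 0 < (patternFunctional t - patternFunctional s) ⬝ᵥ patternGen t k ∧
      patternFunctional s = patternFunctional t -
        ((patternFunctional t - patternFunctional s) ⬝ᵥ patternGen t k) •
          fun m => patternDual t m k := by
  decide +kernel

theorem patternVertex_corner :
    ∀ m, ∃ w, patternVertex w = Pi.single m 1 ∧ patternHeight w = 0 := by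
  decide +kernel

theorem patternVertex_mem_range_patternGen_iff {t : Fin 21} {w : Fin 13} :
    patternVertex w ∈ Set.range (patternGen t) ↔ ∃ k, patternTriangle t k = w :=
  exists_congr fun _ => patternVertex_injective.eq_iff

theorem patternGen_mul_patternDual (t : Fin 21) : patternGen t * patternDual t = 1 := by
  rw [patternDual, Matrix.mul_smul, mul_adjugate, smul_smul, patternGen_det_mul_self, one_smul]

theorem patternGen_det_isUnit (t : Fin 21) : IsUnit (patternGen t).det :=
  isUnit_det_of_right_inverse (patternGen_mul_patternDual t)

theorem coords_eq_vecMul_of_mul_eq_one {A B : Matrix (Fin n) (Fin n) ℤ} (h : A * B = 1)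
    (x : Fin n → ℝ) : coords A x = x ᵥ* B.map (Int.cast : ℤ → ℝ) := by
  have hmap : A.map (Int.cast : ℤ → ℝ) * B.map (Int.cast : ℤ → ℝ) = 1 := by
    have hcast := congrArg (Int.castRingHom ℝ).mapMatrix h
    rwa [map_mul, map_one] at hcast
  rw [coords, vecMulLinear_apply, inv_eq_right_inv hmap]

theorem latticeHom_dotProduct (v w : Fin n → ℤ) :
    latticeHom n v ⬝ᵥ latticeHom n w = (v ⬝ᵥ w : ℤ) := by
  simp [dotProduct, latticeHom_apply]

theorem coords_patternGen_apply (t : Fin 21) (x : Fin 3 → ℝ) (k : Fin 3) :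
    coords (patternGen t) x k = latticeHom 3 (fun m => patternDual t m k) ⬝ᵥ x := by
  rw [coords_eq_vecMul_of_mul_eq_one (patternGen_mul_patternDual t)]
  exact dotProduct_comm _ _

theorem patternGen_cover (x : Fin 3 → ℝ) (hx : 0 ≤ x) : ∃ t, 0 ≤ coords (patternGen t) x := by
  obtain ⟨t, ht⟩ := Finite.exists_max fun t => latticeHom 3 (patternFunctional t) ⬝ᵥ x
  refine ⟨t, fun k => ?_⟩
  rw [coords_patternGen_apply]
  rcases patternDual_cases t k with hboundary | ⟨s, hpos, hs⟩
  · refine dotProduct_nonneg_of_nonneg (fun m => ?_) hx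
    rw [latticeHom_apply]
    exact Int.cast_nonneg (hboundary m)
  · have hle := ht s
    rw [hs, map_sub, latticeHom_smul, sub_dotProduct, smul_dotProduct, smul_eq_mul,
      sub_le_self_iff] at hle
    exact nonneg_of_mul_nonneg_right hle (Int.cast_pos.2 hpos)

theorem isPattern_patternGen : IsPattern patternGen fun t =>
    dotProductEquiv ℝ (Fin 3) (latticeHom 3 (patternFunctional t)) := by
  have hle (t : Fin 21) (w : Fin 13) :
      latticeHom 3 (patternFunctional t) ⬝ᵥ latticeHom 3 (patternVertex w) ≤ patternHeight w := by
    rw [latticeHom_dotProduct]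
    exact_mod_cast (patternFunctional_dotProduct_patternVertex t w).1
  have heq (t : Fin 21) (w : Fin 13) :
      latticeHom 3 (patternFunctional t) ⬝ᵥ latticeHom 3 (patternVertex w) = patternHeight w ↔
        patternVertex w ∈ Set.range (patternGen t) := by
    rw [latticeHom_dotProduct, patternVertex_mem_range_patternGen_iff, Int.cast_inj]
    exact (patternFunctional_dotProduct_patternVertex t w).2
  have hself (t : Fin 21) (k : Fin 3) :
      latticeHom 3 (patternFunctional t) ⬝ᵥ latticeHom 3 (patternGen t k) =
        patternHeight (patternTriangle t k) := (heq _ _).2 ⟨k, rfl⟩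
  refine ⟨fun t => (patternGen_det_isUnit t).ne_zero, patternGen_cover,
    ⟨fun t s k => ?_, fun t s k => ?_⟩, fun t k => patternVertex_cases _, fun t m => ?_,
    fun t m => ?_⟩
  · rw [dotProductEquiv_apply_apply, dotProductEquiv_apply_apply, hself]
    exact hle _ _
  · rw [dotProductEquiv_apply_apply, dotProductEquiv_apply_apply, hself]
    exact heq _ _
  all_goals
    obtain ⟨w, hw, hheight⟩ := patternVertex_corner m
    rw [dotProductEquiv_apply_apply, ← latticeHom_single, ← hw, ← Int.cast_zero, ← hheight]
  · exact hle t w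
  · exact heq t w

/-- Every maximal cone of the pattern that contains the ray `w` contains `p` or `q`. This is what is
left of the condition that `w` is the new ray of a blow-up of a cone with the rays `p` and `q`. -/
def PatternCovers (w p q : Fin 13) : Prop :=
  ∀ t, (∃ k, patternTriangle t k = w) →
    (∃ k, patternTriangle t k = p) ∨ ∃ k, patternTriangle t k = q

instance (w p q : Fin 13) : Decidable (PatternCovers w p q) :=
  inferInstanceAs (Decidable (∀ _, _))

theorem not_patternCovers_self : ∀ w p, p ≠ w → ¬ PatternCovers w p p := by
  decide +kernel

theorem patternVertex_add_ne : ∀ w p q, p ≠ w → q ≠ w → PatternCovers w p q →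
    patternVertex p + patternVertex q ≠ patternVertex w := by
  decide +kernel

theorem patternVertex_add_add_ne : ∀ w p q, p ≠ w → q ≠ w → PatternCovers w p q →
    ∀ r, r ≠ w → PatternCovers w p r → PatternCovers w q r →
      patternVertex p + patternVertex q + patternVertex r ≠ patternVertex w := by
  decide +kernel

theorem patternVertex_sum_ne {m : ℕ} (h2 : 2 ≤ m) (h3 : m ≤ 3) {w : Fin 13} {f : Fin m → Fin 13}
    (hf : ∀ a, f a ≠ w) (hcov : ∀ a b, a ≠ b → PatternCovers w (f a) (f b)) :
    ∑ a, patternVertex (f a) ≠ patternVertex w := by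
  obtain rfl | rfl : m = 2 ∨ m = 3 := by omega
  · rw [Fin.sum_univ_two]
    exact patternVertex_add_ne w _ _ (hf 0) (hf 1) (hcov 0 1 (by decide))
  · rw [Fin.sum_univ_three]
    exact patternVertex_add_add_ne w _ _ (hf 0) (hf 1) (hcov 0 1 (by decide)) _ (hf 2)
      (hcov 0 2 (by decide)) (hcov 1 2 (by decide))

theorem exists_patternVertex_vecMul_eq {B : Matrix (Fin 3) (Fin 3) ℤ} (hB : B.det ≠ 0)
    {p : Fin 21} {k : Fin 3} {v u : Fin 3 → ℤ} (hu : u ≠ (patternGen p * B) k)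
    (hcov : ∀ t, (patternGen p * B) k ∈ Set.range (patternGen t * B) →
      v ∈ Set.range (patternGen t * B) ∨ u ∈ Set.range (patternGen t * B)) :
    ∃ w, patternVertex w ᵥ* B = v := by
  by_contra! hne
  have hmem (t : Fin 21) (ht : (patternGen p * B) k ∈ Set.range (patternGen t * B)) :
      u ∈ Set.range (patternGen t * B) :=
    (hcov t ht).resolve_left fun ⟨l, hl⟩ => hne _ (hl ▸ (mul_apply_eq_vecMul _ _ l).symm)
  obtain ⟨l, rfl⟩ := hmem p ⟨k, rfl⟩
  simp only [mul_apply_eq_vecMul, vecMul_mem_range_mul_iff hB] at hu hmem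
  exact not_patternCovers_self (patternTriangle p k) (patternTriangle p l)
    (fun h => hu (congrArg (fun w => patternVertex w ᵥ* B) h)) fun t ht =>
      Or.inl (patternVertex_mem_range_patternGen_iff.1
        (hmem t (patternVertex_mem_range_patternGen_iff.2 ht)))

theorem sum_ne_patternGen_mul {B : Matrix (Fin 3) (Fin 3) ℤ} (hB : B.det ≠ 0) {m : ℕ}
    (h2 : 2 ≤ m) (h3 : m ≤ 3) {p : Fin 21} {k : Fin 3} {α : Fin m → Fin 3 → ℤ}
    (hα : ∀ a, α a ≠ (patternGen p * B) k)
    (hcov : ∀ a b, a ≠ b → ∀ t, (patternGen p * B) k ∈ Set.range (patternGen t * B) →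
      α a ∈ Set.range (patternGen t * B) ∨ α b ∈ Set.range (patternGen t * B)) :
    ∑ a, α a ≠ (patternGen p * B) k := by
  have : Nontrivial (Fin m) := Fin.nontrivial_iff_two_le.2 h2
  have hvertex (a : Fin m) : ∃ w, patternVertex w ᵥ* B = α a := by
    obtain ⟨b, hba⟩ := exists_ne a
    exact exists_patternVertex_vecMul_eq hB (hα b) (hcov a b hba.symm)
  choose f hf using hvertex
  simp only [← hf, mul_apply_eq_vecMul, vecMul_mem_range_mul_iff hB, ← sum_vecMul] at hα hcov ⊢
  intro hsum
  refine patternVertex_sum_ne h2 h3 (f := f) (w := patternTriangle p k)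
    (fun a h => hα a (congrArg (fun w => patternVertex w ᵥ* B) h)) (fun a b hab t ht => ?_)
    (vecMul_injective_of_det_ne_zero hB hsum)
  simp only [← patternVertex_mem_range_patternGen_iff] at ht ⊢
  exact hcov a b hab t ht

end Pattern

section FaceCone

variable {A : Matrix (Fin n) (Fin n) ℤ} {I J : Set (Fin n)}

/-- The cone generated by the rows of `A` with index in `I`, a face of the cone generated by all
rows if `A` is invertible. -/
def faceCone (A : Matrix (Fin n) (Fin n) ℤ) (I : Set (Fin n)) : PointedCone ℝ (Fin n → ℝ) :=
  PointedCone.hull ℝ ((fun k => latticeHom n (A k)) '' I)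

theorem row_mem_faceCone {k : Fin n} (hk : k ∈ I) : latticeHom n (A k) ∈ faceCone A I :=
  PointedCone.subset_hull ⟨k, hk, rfl⟩

theorem faceCone_le {C : PointedCone ℝ (Fin n → ℝ)} (h : ∀ k ∈ I, latticeHom n (A k) ∈ C) :
    faceCone A I ≤ C :=
  Submodule.span_le.2 (Set.image_subset_iff.2 h)

theorem mem_faceCone (hA : A.det ≠ 0) {x : Fin n → ℝ} :
    x ∈ faceCone A I ↔ 0 ≤ coords A x ∧ ∀ k, coords A x k ≠ 0 → k ∈ I := by
  refine ⟨fun hx => ?_, fun ⟨hnonneg, hsupp⟩ =>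
    mem_hull_of_coords hA hnonneg fun k hk => ⟨k, hsupp k hk, rfl⟩⟩
  induction hx using Submodule.span_induction with
  | mem x hx =>
    obtain ⟨k, hk, rfl⟩ := hx
    rw [coords_row hA]
    refine ⟨Pi.single_nonneg.2 zero_le_one, fun l hl => ?_⟩
    obtain rfl : l = k := by
      by_contra hlk
      exact hl (Pi.single_eq_of_ne hlk _)
    exact hk
  | zero => simp
  | add x y _ _ hx hy =>
    rw [map_add]
    refine ⟨add_nonneg hx.1 hy.1, fun k hk => ?_⟩
    by_contra hkI
    rw [Pi.add_apply, not_not.1 (mt (hx.2 k) hkI), not_not.1 (mt (hy.2 k) hkI), add_zero] at hk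
    exact hk rfl
  | smul c x _ hx =>
    have hcoords : coords A (c • x) = (c : ℝ) • coords A x := map_smul _ (c : ℝ) x
    rw [hcoords]
    exact ⟨smul_nonneg c.2 hx.1, fun k hk => hx.2 k (right_ne_zero_of_mul hk)⟩

theorem mem_faceCone_univ (hA : A.det ≠ 0) {x : Fin n → ℝ} :
    x ∈ faceCone A Set.univ ↔ 0 ≤ coords A x := by
  simp [mem_faceCone hA]

theorem faceCone_isFaceOf (hA : A.det ≠ 0) (hIJ : I ⊆ J) :
    (faceCone A I).IsFaceOf (faceCone A J) := by
  refine PointedCone.IsFaceOf.of_mem_of_add_mem_left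
    (faceCone_le fun k hk => row_mem_faceCone (hIJ hk)) fun {x y} hx hy hxy => ?_
  rw [mem_faceCone hA] at hx hy hxy ⊢
  refine ⟨hx.1, fun k hk => hxy.2 k ?_⟩
  rw [map_add]
  exact (add_pos_of_pos_of_nonneg (lt_of_le_of_ne (hx.1 k) hk.symm) (hy.1 k)).ne'

theorem row_mem_of_isFaceOf (hA : A.det ≠ 0) {F : PointedCone ℝ (Fin n → ℝ)}
    (hF : F.IsFaceOf (faceCone A I)) {x : Fin n → ℝ} (hx : x ∈ F) {k : Fin n}
    (hk : coords A x k ≠ 0) : latticeHom n (A k) ∈ F := by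
  obtain ⟨hnonneg, hsupp⟩ := (mem_faceCone hA).1 (hF.le hx)
  have hterm (l : Fin n) : coords A x l • latticeHom n (A l) ∈ faceCone A I := by
    by_cases hl : coords A x l = 0
    · rw [hl, zero_smul]
      exact zero_mem _
    · exact PointedCone.smul_mem _ (hnonneg l) (row_mem_faceCone (hsupp l hl))
  have hmem := F.smul_mem (inv_nonneg.2 (hnonneg k))
    (hF.mem_of_sum_mem hterm (by rwa [sum_coords hA]) k)
  rwa [smul_smul, inv_mul_cancel₀ hk, one_smul] at hmem

theorem eq_faceCone_of_isFaceOf (hA : A.det ≠ 0) {F : PointedCone ℝ (Fin n → ℝ)}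
    (hF : F.IsFaceOf (faceCone A I)) : F = faceCone A {k | latticeHom n (A k) ∈ F} :=
  le_antisymm (fun _ hx => (mem_faceCone hA).2 ⟨((mem_faceCone hA).1 (hF.le hx)).1,
    fun _ => row_mem_of_isFaceOf hA hF hx⟩) (faceCone_le fun _ hk => hk)

theorem isFullDimCone_faceCone_univ (hA : A.det ≠ 0) : IsFullDimCone (faceCone A Set.univ) := by
  refine eq_top_iff.2 fun x _ => ?_
  rw [← sum_coords hA x]
  exact Submodule.sum_mem _ fun k _ => Submodule.smul_mem _ _
    (Submodule.subset_span (row_mem_faceCone (Set.mem_univ k)))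

theorem det_ne_zero_of_natAbs_eq_one (hA : A.det.natAbs = 1) : A.det ≠ 0 :=
  (Int.isUnit_iff_natAbs_eq.2 hA).ne_zero

theorem exists_vecMul_eq (hA : A.det.natAbs = 1) (z : Fin n → ℤ) : ∃ c : Fin n → ℤ, c ᵥ* A = z :=
  vecMul_surjective_iff_isUnit.2
    ((isUnit_iff_isUnit_det A).2 (Int.isUnit_iff_natAbs_eq.2 hA)) z

theorem isPrimitive_of_gcd_dvd_one {v : Fin n → ℤ} (hv : Finset.univ.gcd v ∣ 1) :
    IsPrimitive v := by
  rw [IsPrimitive, ← Finset.normalize_gcd, normalize_eq_one]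
  exact isUnit_of_dvd_one hv

theorem isPrimitive_row (hA : A.det.natAbs = 1) (k : Fin n) : IsPrimitive (A k) := by
  have hsum : ∑ j, A k j * A⁻¹ j k = 1 := by
    have hinv := congrFun (congrFun (mul_nonsing_inv A (Int.isUnit_iff_natAbs_eq.2 hA)) k) k
    rwa [mul_apply, one_apply_eq] at hinv
  refine isPrimitive_of_gcd_dvd_one ?_
  rw [← hsum]
  exact Finset.dvd_sum fun j _ => (Finset.gcd_dvd (Finset.mem_univ j)).mul_right _

theorem coords_eq_zero_of_mem_span (hA : A.det ≠ 0) {m : ℕ} {e : Fin m → Fin n} {x : Fin n → ℝ}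
    (hx : x ∈ Submodule.span ℝ (Set.range fun j => latticeHom n (A (e j)))) {k : Fin n}
    (hk : k ∉ Set.range e) : coords A x k = 0 := by
  have hle : Submodule.span ℝ (Set.range fun j => latticeHom n (A (e j))) ≤
      LinearMap.ker (LinearMap.proj k ∘ₗ coords A) := by
    refine Submodule.span_le.2 (Set.range_subset_iff.2 fun j => ?_)
    rw [SetLike.mem_coe, LinearMap.mem_ker, LinearMap.comp_apply, LinearMap.proj_apply,
      coords_row hA]
    exact Pi.single_eq_of_ne (fun h => hk ⟨j, h.symm⟩) _
  exact hle hx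

theorem coneMultiplicity_rows (hA : A.det.natAbs = 1) {m : ℕ} (e : Fin m → Fin n) :
    coneMultiplicity (fun j => A (e j)) = 1 := by
  have hdet := det_ne_zero_of_natAbs_eq_one hA
  rw [coneMultiplicity, AddSubgroup.relIndex_eq_one]
  intro z hz
  obtain ⟨c, rfl⟩ := exists_vecMul_eq hA z
  rw [vecMul_eq_sum]
  refine AddSubgroup.sum_mem _ fun k _ => ?_
  by_cases hk : k ∈ Set.range e
  · obtain ⟨j, rfl⟩ := hk
    exact AddSubgroup.zsmul_mem _ (AddSubgroup.subset_closure (Set.mem_range_self j)) _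
  · have hc := coords_eq_zero_of_mem_span hdet hz hk
    rw [coords_latticeHom_vecMul hdet, latticeHom_apply, Int.cast_eq_zero] at hc
    rw [hc, zero_smul]
    exact zero_mem _

theorem isUnimodularCone_faceCone (hA : A.det.natAbs = 1) (I : Set (Fin n)) :
    IsUnimodularCone (faceCone A I) := by
  let e := (Finite.equivFin I).symm
  refine ⟨Nat.card I, fun j => A (e j), ⟨fun j => isPrimitive_row hA _,
    (linearIndependent_rows (det_ne_zero_of_natAbs_eq_one hA)).comp (fun j => (e j : Fin n))
      (Subtype.val_injective.comp e.injective), ?_⟩, coneMultiplicity_rows hA _⟩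
  rw [faceCone, Set.image_eq_range]
  exact congrArg (PointedCone.hull ℝ) (e.surjective.range_comp fun k : I => latticeHom n (A k))

end FaceCone

section Fan

variable {g : ι → Matrix (Fin n) (Fin n) ℤ}

theorem IsConvexFan.faceCone_support_le (hg : IsConvexFan g) {i j : ι} {x : Fin n → ℝ}
    (hi : 0 ≤ coords (g i) x) (hj : 0 ≤ coords (g j) x) :
    faceCone (g i) {k | coords (g i) x k ≠ 0} ≤ faceCone (g j) {k | coords (g j) x k ≠ 0} :=
  faceCone_le fun k hk => by
    obtain ⟨l, hl, hcoord⟩ := hg.exists_row hi hj hk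
    rw [← hl]
    exact row_mem_faceCone (hcoord.trans_ne hk)

theorem IsConvexFan.faceCone_inf (hg : IsConvexFan g) (i j : ι) (I J : Set (Fin n)) :
    faceCone (g i) I ⊓ faceCone (g j) J = faceCone (g i) (I ∩ {k | ∃ l ∈ J, g j l = g i k}) := by
  refine le_antisymm (fun x hx => ?_) (le_inf (faceCone_le fun k hk => row_mem_faceCone hk.1) ?_)
  · obtain ⟨hi, hI⟩ := (mem_faceCone (hg.det_ne_zero i)).1 hx.1
    obtain ⟨hj, hJ⟩ := (mem_faceCone (hg.det_ne_zero j)).1 hx.2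
    refine (mem_faceCone (hg.det_ne_zero i)).2 ⟨hi, fun k hk => ⟨hI k hk, ?_⟩⟩
    obtain ⟨l, hl, hcoord⟩ := hg.exists_row hi hj hk
    exact ⟨l, hJ l (hcoord ▸ hk), hl⟩
  · refine faceCone_le ?_
    rintro k ⟨-, l, hl, hlk⟩
    rw [← hlk]
    exact row_mem_faceCone hl

/-- The fan whose maximal cones are generated by the rows of the matrices `g i`. -/
def IsConvexFan.toFan [Finite ι] (hg : IsConvexFan g) : PolyhedralFan n where
  cones := Set.range fun p : ι × Set (Fin n) => faceCone (g p.1) p.2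
  finite := Set.finite_range _
  nonempty := by
    obtain ⟨i, -⟩ := hg.cover 0
    exact ⟨_, (i, ∅), rfl⟩
  polyhedral := by
    rintro _ ⟨⟨i, I⟩, rfl⟩
    exact Submodule.fg_span (I.toFinite.image _)
  face_mem := by
    rintro _ ⟨⟨i, I⟩, rfl⟩ F hF
    exact ⟨(i, _), (eq_faceCone_of_isFaceOf (hg.det_ne_zero i) hF).symm⟩
  inf_isFaceOf_left := by
    rintro _ ⟨⟨i, I⟩, rfl⟩ _ ⟨⟨j, J⟩, rfl⟩
    simp only [hg.faceCone_inf]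
    exact faceCone_isFaceOf (hg.det_ne_zero i) Set.inter_subset_left
  inf_isFaceOf_right := by
    rintro _ ⟨⟨i, I⟩, rfl⟩ _ ⟨⟨j, J⟩, rfl⟩
    rw [inf_comm]
    simp only [hg.faceCone_inf]
    exact faceCone_isFaceOf (hg.det_ne_zero j) Set.inter_subset_left

variable [Finite ι]

theorem IsConvexFan.toFan_isComplete (hg : IsConvexFan g) : hg.toFan.IsComplete := fun x => by
  obtain ⟨i, hi⟩ := hg.cover x
  exact ⟨_, ⟨(i, Set.univ), rfl⟩, (mem_faceCone_univ (hg.det_ne_zero i)).2 hi⟩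

theorem IsConvexFan.toFan_isUnimodular (hg : IsConvexFan g) (hdet : ∀ i, (g i).det.natAbs = 1) :
    hg.toFan.IsUnimodular := by
  constructor
  · obtain ⟨i, -⟩ := hg.cover 0
    exact ⟨_, ⟨(i, Set.univ), rfl⟩, isFullDimCone_faceCone_univ (hg.det_ne_zero i)⟩
  · rintro _ ⟨⟨i, I⟩, rfl⟩
    exact isUnimodularCone_faceCone (hdet i) I

theorem IsConvexFan.toFan_refines (hg : IsConvexFan g) {S : PolyhedralFan n}
    (h : ∀ i, ∃ C ∈ S.cones, ∀ k, latticeHom n (g i k) ∈ C) : hg.toFan.Refines S := by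
  rintro _ ⟨⟨i, I⟩, rfl⟩
  obtain ⟨C, hC, hk⟩ := h i
  exact ⟨C, hC, faceCone_le fun k _ => hk k⟩

theorem IsConvexFan.exists_coords_sub_smul_nonneg (hg : IsConvexFan g) (a b : Fin n → ℝ) :
    ∃ j, 0 ≤ coords (g j) a ∧ ∃ ε > (0 : ℝ), 0 ≤ coords (g j) (a - ε • b) := by
  obtain ⟨j, hj⟩ : ∃ j, ∃ᶠ ε : ℝ in 𝓝[>] 0, 0 ≤ coords (g j) (a - ε • b) := by
    by_contra! hcon
    obtain ⟨ε, hε⟩ := (eventually_all.2 hcon).exists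
    obtain ⟨j, hj⟩ := hg.cover (a - ε • b)
    exact hε j hj
  have hclosed : IsClosed {x | 0 ≤ coords (g j) x} :=
    isClosed_le continuous_const (coords (g j)).continuous_of_finiteDimensional
  have hlim : Tendsto (fun ε : ℝ => a - ε • b) (𝓝[>] 0) (𝓝 a) :=
    ((by fun_prop : Continuous fun ε : ℝ => a - ε • b).tendsto' 0 a (by simp)).mono_left
      nhdsWithin_le_nhds
  obtain ⟨ε, hε, hpos⟩ := (hj.and_eventually self_mem_nhdsWithin).exists
  exact ⟨j, hclosed.mem_of_frequently_of_tendsto hj hlim, ε, hpos, hε⟩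

end Fan

section Polytope

variable {g : ι → Matrix (Fin n) (Fin n) ℤ} {y : ι → Module.Dual ℝ (Fin n → ℝ)} {i : ι}
  {a : Fin n → ℝ}

/-- The polytope spanned by the functionals `y i`, considered as points of `ℝⁿ` through the standard
scalar product. Its support function is the maximum of the functionals. -/
def supportPolytope (y : ι → Module.Dual ℝ (Fin n → ℝ)) : Set (Fin n → ℝ) :=
  convexHull ℝ (Set.range fun i => (dotProductEquiv ℝ (Fin n)).symm (y i))

theorem dotProduct_dotProductEquiv_symm (f : Module.Dual ℝ (Fin n → ℝ)) (x : Fin n → ℝ) :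
    x ⬝ᵥ (dotProductEquiv ℝ (Fin n)).symm f = f x := by
  rw [dotProduct_comm, ← dotProductEquiv_apply_apply, LinearEquiv.apply_symm_apply]

theorem dotProduct_le_of_mem_supportPolytope {c : ℝ} (h : ∀ j, y j a ≤ c) {q : Fin n → ℝ}
    (hq : q ∈ supportPolytope y) : a ⬝ᵥ q ≤ c := by
  have hconv : Convex ℝ {q : Fin n → ℝ | a ⬝ᵥ q ≤ c} :=
    convex_halfSpace_le ⟨fun _ _ => dotProduct_add _ _ _, fun _ _ => dotProduct_smul _ _ _⟩ _
  refine convexHull_min (Set.range_subset_iff.2 fun j => ?_) hconv hq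
  exact (dotProduct_dotProductEquiv_symm (y j) a).trans_le (h j)

theorem symm_mem_supportPolytope (y : ι → Module.Dual ℝ (Fin n → ℝ)) (i : ι) :
    (dotProductEquiv ℝ (Fin n)).symm (y i) ∈ supportPolytope y :=
  subset_convexHull ℝ _ ⟨i, rfl⟩

theorem IsSupport.symm_mem_faceInDirection (hy : IsSupport g y) (hi : (g i).det ≠ 0)
    (ha : 0 ≤ coords (g i) a) :
    (dotProductEquiv ℝ (Fin n)).symm (y i) ∈ faceInDirection (supportPolytope y) a := by
  refine ⟨symm_mem_supportPolytope y i, fun q hq => ?_⟩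
  rw [dotProduct_sub, sub_nonneg, dotProduct_dotProductEquiv_symm]
  exact dotProduct_le_of_mem_supportPolytope (fun j => hy.map_le hi j ha) hq

theorem IsSupport.row_dotProduct_eq (hy : IsSupport g y) (hi : (g i).det ≠ 0)
    (ha : 0 ≤ coords (g i) a) {p : Fin n → ℝ} (hp : p ∈ faceInDirection (supportPolytope y) a)
    {k : Fin n} (hk : coords (g i) a k ≠ 0) :
    latticeHom n (g i k) ⬝ᵥ p = y i (latticeHom n (g i k)) := by
  let f := dotProductEquiv ℝ (Fin n) p
  have hrow (l : Fin n) : f (latticeHom n (g i l)) ≤ y i (latticeHom n (g i l)) := by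
    rw [dotProductEquiv_apply_apply, dotProduct_comm]
    exact dotProduct_le_of_mem_supportPolytope (fun j => hy.le i j l) hp.1
  have hmax : y i a ≤ f a := by
    have hle := hp.2 _ (symm_mem_supportPolytope y i)
    rwa [dotProduct_sub, sub_nonneg, dotProduct_dotProductEquiv_symm, dotProduct_comm] at hle
  have hterm (l : Fin n) : coords (g i) a l * f (latticeHom n (g i l)) ≤
      coords (g i) a l * y i (latticeHom n (g i l)) :=
    mul_le_mul_of_nonneg_left (hrow l) (ha l)
  rw [map_eq_sum_coords hi (y i), map_eq_sum_coords hi f] at hmax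
  have heq := (Finset.sum_eq_sum_iff_of_le fun l _ => hterm l).1
    ((Finset.sum_le_sum fun l _ => hterm l).antisymm hmax) k (Finset.mem_univ k)
  rw [dotProduct_comm]
  exact mul_left_cancel₀ hk heq

theorem IsSupport.faceCone_le_normalCone (hy : IsSupport g y) (hi : (g i).det ≠ 0)
    (ha : 0 ≤ coords (g i) a) :
    faceCone (g i) {k | coords (g i) a k ≠ 0} ≤
      normalCone (supportPolytope y) (faceInDirection (supportPolytope y) a) :=
  faceCone_le fun k hk p hp q hq => by
    rw [dotProduct_sub, sub_nonneg, hy.row_dotProduct_eq hi ha hp hk]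
    exact dotProduct_le_of_mem_supportPolytope (fun j => hy.le i j k) hq

theorem IsSupport.coords_nonneg_of_mem_normalCone (hy : IsSupport g y) (hg : IsConvexFan g)
    (ha : 0 ≤ coords (g i) a) {b : Fin n → ℝ}
    (hb : b ∈ normalCone (supportPolytope y) (faceInDirection (supportPolytope y) a)) :
    0 ≤ coords (g i) b := by
  obtain ⟨j, hj⟩ := hg.cover b
  have hle := hb _ (hy.symm_mem_faceInDirection (hg.det_ne_zero i) ha) _
    (symm_mem_supportPolytope y j)
  rw [dotProduct_sub, sub_nonneg, dotProduct_dotProductEquiv_symm,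
    dotProduct_dotProductEquiv_symm] at hle
  exact (hy.map_eq_iff (hg.det_ne_zero j) (hg.det_ne_zero i) hj).1
    ((hy.map_le (hg.det_ne_zero j) i hj).antisymm hle)

variable [Finite ι]

theorem IsSupport.normalCone_le_faceCone (hy : IsSupport g y) (hg : IsConvexFan g)
    (ha : 0 ≤ coords (g i) a) :
    normalCone (supportPolytope y) (faceInDirection (supportPolytope y) a) ≤
      faceCone (g i) {k | coords (g i) a k ≠ 0} := fun b hb => by
  obtain ⟨j, haj, ε, hε, hab⟩ := hg.exists_coords_sub_smul_nonneg a b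
  have hbj := hy.coords_nonneg_of_mem_normalCone hg haj hb
  refine hg.faceCone_support_le haj ha ((mem_faceCone (hg.det_ne_zero j)).2 ⟨hbj, fun k hk => ?_⟩)
  have hle : ε * coords (g j) b k ≤ coords (g j) a k := by
    simpa only [map_sub, map_smul, Pi.zero_apply, Pi.sub_apply, Pi.smul_apply, smul_eq_mul,
      sub_nonneg] using hab k
  exact ((mul_pos hε (lt_of_le_of_ne (hbj k) hk.symm)).trans_le hle).ne'

theorem IsSupport.normalCone_eq_faceCone (hy : IsSupport g y) (hg : IsConvexFan g)
    (ha : 0 ≤ coords (g i) a) :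
    normalCone (supportPolytope y) (faceInDirection (supportPolytope y) a) =
      faceCone (g i) {k | coords (g i) a k ≠ 0} :=
  (hy.normalCone_le_faceCone hg ha).antisymm (hy.faceCone_le_normalCone (hg.det_ne_zero i) ha)

theorem exists_coords_support_eq {A : Matrix (Fin n) (Fin n) ℤ} (hA : A.det ≠ 0)
    (I : Set (Fin n)) : ∃ x, 0 ≤ coords A x ∧ {k | coords A x k ≠ 0} = I := by
  refine ⟨∑ k, I.indicator (1 : Fin n → ℝ) k • latticeHom n (A k), ?_, ?_⟩
  · rw [coords_sum hA]
    exact Set.indicator_nonneg fun _ _ => zero_le_one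
  · rw [coords_sum hA]
    ext k
    simp

theorem IsConvexFan.toFan_isPolytopal (hg : IsConvexFan g) : hg.toFan.IsPolytopal := by
  obtain ⟨y, hy⟩ := hg.exists_isSupport
  have hfin := Set.finite_range fun i => (dotProductEquiv ℝ (Fin n)).symm (y i)
  refine ⟨hfin.toFinset, ?_, ?_⟩
  · obtain ⟨i, -⟩ := hg.cover 0
    exact hfin.toFinset_nonempty.2 ⟨_, i, rfl⟩
  rw [hfin.coe_toFinset]
  refine Set.Subset.antisymm ?_ ?_
  · rintro _ ⟨⟨i, I⟩, rfl⟩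
    obtain ⟨a, ha, rfl⟩ := exists_coords_support_eq (hg.det_ne_zero i) I
    exact ⟨a, hy.normalCone_eq_faceCone hg ha⟩
  · rintro _ ⟨a, rfl⟩
    obtain ⟨i, hi⟩ := hg.cover a
    exact ⟨(i, _), (hy.normalCone_eq_faceCone hg hi).symm⟩

end Polytope

section Generators

variable {m : ℕ} {α : Fin m → Fin n → ℤ} {C : PointedCone ℝ (Fin n → ℝ)}

theorem IsPrimitive.ne_zero {v : Fin n → ℤ} (hv : IsPrimitive v) : v ≠ 0 := by
  rintro rfl
  exact zero_ne_one ((Finset.gcd_eq_zero_iff.2 fun _ _ => rfl).symm.trans hv)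

theorem IsPrimitive.eq_of_latticeHom_eq_smul {v w : Fin n → ℤ} (hv : IsPrimitive v)
    (hw : IsPrimitive w) {s : ℝ} (hs : 0 ≤ s) (h : latticeHom n v = s • latticeHom n w) :
    v = w := by
  obtain ⟨u, hu⟩ := Finset.univ.gcd_eq_sum_mul w
  replace hu : 1 = ∑ i, w i * u i := hw.symm.trans hu
  have hsz : s = (∑ i, v i * u i : ℤ) := by
    have hvw (i : Fin n) : (v i : ℝ) = s * w i := congrFun h i
    calc s = s * (∑ i, w i * u i : ℤ) := by rw [← hu, Int.cast_one, mul_one]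
      _ = (∑ i, v i * u i : ℤ) := by
        simp only [Int.cast_sum, Int.cast_mul, hvw, mul_assoc, Finset.mul_sum]
  rw [hsz, ← latticeHom_smul] at h
  replace h := latticeHom_injective h
  have hdvd : ∑ i, v i * u i ∣ 1 := by
    rw [← hv]
    exact Finset.dvd_gcd fun i _ => ⟨w i, congrFun h i⟩
  have hone : ∑ i, v i * u i = 1 :=
    Int.eq_one_of_dvd_one (by rw [hsz] at hs; exact_mod_cast hs) hdvd
  rw [h, hone, one_smul]

theorem IsPrimitiveGenerators.mem (h : IsPrimitiveGenerators α C) (a : Fin m) :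
    latticeHom n (α a) ∈ C := by
  rw [← h.hull_eq]
  exact PointedCone.subset_hull ⟨a, rfl⟩

theorem IsPrimitiveGenerators.sum_mem (h : IsPrimitiveGenerators α C) :
    latticeHom n (∑ a, α a) ∈ C := by
  rw [map_sum]
  exact Submodule.sum_mem _ fun a _ => h.mem a

theorem IsPrimitiveGenerators.le_of_isFaceOf_of_sum_mem (h : IsPrimitiveGenerators α C)
    {F : PointedCone ℝ (Fin n → ℝ)} (hF : F.IsFaceOf C) (hsum : latticeHom n (∑ a, α a) ∈ F) :
    C ≤ F := by
  rw [map_sum] at hsum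
  rw [← h.hull_eq]
  exact Submodule.span_le.2 (Set.range_subset_iff.2 (hF.mem_of_sum_mem h.mem hsum))

theorem IsPrimitiveGenerators.linearIndependent_int (h : IsPrimitiveGenerators α C) :
    LinearIndependent ℤ α :=
  (h.linearIndependent.restrict_scalars' ℤ).of_comp (latticeHom n).toIntLinearMap

theorem IsPrimitiveGenerators.ne_sum (h : IsPrimitiveGenerators α C) (hm : 2 ≤ m) (a : Fin m) :
    α a ≠ ∑ b, α b := fun hsum => by
  have : Nontrivial (Fin m) := Fin.nontrivial_iff_two_le.2 hm
  obtain ⟨b, hb⟩ := exists_ne a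
  rw [← Finset.add_sum_erase _ _ (Finset.mem_univ a), left_eq_add] at hsum
  exact one_ne_zero (linearIndependent_iff'.1 h.linearIndependent_int (Finset.univ.erase a) 1
    (by simpa only [Pi.one_apply, one_smul] using hsum) b
    (Finset.mem_erase.2 ⟨hb, Finset.mem_univ b⟩))

theorem IsPrimitiveGenerators.hull_image_isFaceOf (h : IsPrimitiveGenerators α C)
    (s : Set (Fin m)) :
    (PointedCone.hull ℝ ((fun a => latticeHom n (α a)) '' s)).IsFaceOf C := by
  have hli : LinearIndepOn ℝ (latticeHom n) (Set.range α) :=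
    (linearIndepOn_range_iff h.linearIndependent_int.injective _).2 h.linearIndependent
  obtain ⟨B, hB, hαB, -⟩ := exists_matrix_range_superset hli
  choose e he using fun a => hαB (Set.mem_range_self a)
  have himage (s : Set (Fin m)) :
      PointedCone.hull ℝ ((fun a => latticeHom n (α a)) '' s) = faceCone B (e '' s) := by
    rw [faceCone, Set.image_image]
    simp only [he]
  rw [← h.hull_eq, ← Set.image_univ, himage, himage]
  exact faceCone_isFaceOf hB (Set.image_mono (Set.subset_univ s))

theorem IsUnimodularGenerators.exists_sum_smul_eq (h : IsUnimodularGenerators α C)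
    {z : Fin n → ℤ}
    (hz : latticeHom n z ∈ Submodule.span ℝ (Set.range fun a => latticeHom n (α a))) :
    ∃ c : Fin m → ℤ, ∑ a, c a • α a = z := by
  rw [← Submodule.mem_span_range_iff_exists_fun, ← Submodule.mem_toAddSubgroup,
    Submodule.span_int_eq_addSubgroupClosure]
  exact AddSubgroup.relIndex_eq_one.1 h.2 hz

theorem IsUnimodularGenerators.isPrimitive_sum (h : IsUnimodularGenerators α C) (hm : 0 < m) :
    IsPrimitive (∑ a, α a) := by
  have hli := Fintype.linearIndependent_iff.1 h.1.linearIndependent_int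
  set d := Finset.univ.gcd (∑ a, α a)
  have hd0 : d ≠ 0 := fun hd0 => one_ne_zero (hli 1 (by
    simp only [Pi.one_apply, one_smul]
    exact funext fun i => Finset.gcd_eq_zero_iff.1 hd0 i (Finset.mem_univ i)) ⟨0, hm⟩)
  choose z hz using fun i => Finset.gcd_dvd (f := ∑ a, α a) (Finset.mem_univ i)
  have hdz : d • z = ∑ a, α a := funext fun i => (hz i).symm
  obtain ⟨c, hc⟩ := h.exists_sum_smul_eq (z := z) (by
    rw [← Submodule.smul_mem_iff _ (Int.cast_ne_zero.2 hd0 : (d : ℝ) ≠ 0), ← latticeHom_smul,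
      hdz, map_sum]
    exact Submodule.sum_mem _ fun a _ => Submodule.subset_span ⟨a, rfl⟩)
  have hdc := hli (fun a => d * c a - 1) (by
    simp only [sub_smul, mul_smul, one_smul, Finset.sum_sub_distrib, ← Finset.smul_sum, hc, hdz,
      sub_self]) ⟨0, hm⟩
  exact isPrimitive_of_gcd_dvd_one ⟨c ⟨0, hm⟩, (sub_eq_zero.1 hdc).symm⟩

end Generators

section BlowUp

variable {A : Matrix (Fin n) (Fin n) ℤ} {g : ι → Matrix (Fin n) (Fin n) ℤ} {m : ℕ}
  {α : Fin m → Fin n → ℤ} {C C₀ C' : PointedCone ℝ (Fin n → ℝ)} {R : PolyhedralFan n} {l₀ : Fin n}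

theorem exists_coords_ne_zero (hA : A.det ≠ 0) {x : Fin n → ℝ} (hx : x ≠ 0) :
    ∃ k, coords A x k ≠ 0 :=
  Function.ne_iff.1 ((map_ne_zero_iff _ (coords_injective hA)).2 hx)

theorem isFaceOf_of_le (hC : C ∈ R.cones) (hC' : C' ∈ R.cones) (h : C ≤ C') : C.IsFaceOf C' := by
  simpa only [inf_eq_left.2 h] using R.inf_isFaceOf_right C hC C' hC'

theorem exists_row_eq_sum [Finite ι] (hg : IsConvexFan g) (hdet : ∀ i, (g i).det.natAbs = 1)
    (hm : 0 < m) (hC : C ∈ R.cones) (hα : IsUnimodularGenerators α C)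
    (hT : hg.toFan.cones = R.stellarCones (latticeHom n (∑ a, α a))) :
    ∃ i k, g i k = ∑ a, α a := by
  set γ := latticeHom n (∑ a, α a)
  have hprim := hα.isPrimitive_sum hm
  have hγ0 : γ ≠ 0 := latticeHom_ne_zero hprim.ne_zero
  have hbot : (⊥ : PointedCone ℝ (Fin n → ℝ)).IsFaceOf C := by
    simpa using hα.1.hull_image_isFaceOf ∅
  obtain ⟨⟨i, I⟩, hray⟩ : PointedCone.hull ℝ (insert γ ((⊥ : PointedCone ℝ (Fin n → ℝ)) :
      Set (Fin n → ℝ))) ∈ hg.toFan.cones := by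
    rw [hT]
    exact Or.inr ⟨⊥, R.face_mem C hC _ hbot, hγ0, ⟨C, hC, bot_le, hα.1.sum_mem⟩, rfl⟩
  replace hray : faceCone (g i) I = PointedCone.hull ℝ (insert γ
    ((⊥ : PointedCone ℝ (Fin n → ℝ)) : Set (Fin n → ℝ))) := hray
  have hγ : γ ∈ faceCone (g i) I := hray ▸ PointedCone.subset_hull (Set.mem_insert _ _)
  obtain ⟨k, hk⟩ := exists_coords_ne_zero (hg.det_ne_zero i) hγ0
  have hrow := row_mem_faceCone (A := g i) (((mem_faceCone (hg.det_ne_zero i)).1 hγ).2 k hk)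
  rw [hray] at hrow
  obtain ⟨t, z, hz, htz⟩ := Submodule.mem_span_insert.1 hrow
  rw [Submodule.span_eq, Submodule.mem_bot] at hz
  rw [hz, add_zero] at htz
  exact ⟨i, k, (isPrimitive_row (hdet i) k).eq_of_latticeHom_eq_smul hprim t.2 htz⟩

theorem row_mem_of_faceCone_eq_hull_insert (hA : A.det ≠ 0) (hC₀ : C₀ ≤ faceCone A Set.univ)
    (h : faceCone A Set.univ = PointedCone.hull ℝ (insert (latticeHom n (A l₀)) C₀)) {l : Fin n}
    (hl : l ≠ l₀) : latticeHom n (A l) ∈ C₀ := by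
  have hrow : latticeHom n (A l) ∈ faceCone A Set.univ := row_mem_faceCone (Set.mem_univ l)
  rw [h] at hrow
  obtain ⟨⟨s, hs⟩, x, hx, hsx⟩ := Submodule.mem_span_insert.1 hrow
  rw [Submodule.span_eq] at hx
  replace hsx : latticeHom n (A l) = s • latticeHom n (A l₀) + x := hsx
  have hcoord := congrFun (congrArg (coords A) hsx) l₀
  rw [map_add, map_smul, coords_row hA, coords_row hA, Pi.single_eq_of_ne hl.symm, Pi.add_apply,
    Pi.smul_apply, Pi.single_eq_same, smul_eq_mul, mul_one] at hcoord
  have hs0 : s = 0 :=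
    ((add_eq_zero_iff_of_nonneg hs ((mem_faceCone_univ hA).1 (hC₀ hx) l₀)).1 hcoord.symm).1
  rwa [hsx, hs0, zero_smul, zero_add]

theorem coords_pos_of_notMem (hA : A.det ≠ 0) (hface : C₀.IsFaceOf C')
    (hrows : ∀ l ≠ l₀, latticeHom n (A l) ∈ C₀) (hl₀ : latticeHom n (A l₀) ∈ C')
    {x : Fin n → ℝ} (hx : x ∈ C') (hxC₀ : x ∉ C₀) : 0 < coords A x l₀ := by
  contrapose! hxC₀
  have hrow (l : Fin n) : latticeHom n (A l) ∈ C' := by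
    obtain rfl | hl := eq_or_ne l l₀
    exacts [hl₀, hface.le (hrows l hl)]
  have hneg : ∑ l, (coords A x l)⁻ • latticeHom n (A l) ∈ C' :=
    Submodule.sum_mem _ fun l _ => C'.smul_mem (negPart_nonneg _) (hrow l)
  have hpos : ∑ l, (coords A x l)⁺ • latticeHom n (A l) ∈ C₀ := by
    refine Submodule.sum_mem _ fun l _ => ?_
    obtain rfl | hl := eq_or_ne l l₀
    · rw [posPart_eq_zero.2 hxC₀, zero_smul]
      exact zero_mem _
    · exact C₀.smul_mem (posPart_nonneg _) (hrows l hl)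
  have hadd : x + ∑ l, (coords A x l)⁻ • latticeHom n (A l) =
      ∑ l, (coords A x l)⁺ • latticeHom n (A l) := by
    rw [← eq_sub_iff_add_eq, ← Finset.sum_sub_distrib]
    simp only [← sub_smul, posPart_sub_negPart, sum_coords hA]
  exact hface.mem_of_add_mem_left hx hneg (hadd ▸ hpos)

theorem eq_zero_or_eq_zero_of_sum_eq_one {κ : Type*} [Fintype κ] {c : κ → ℤ} (hc : 0 ≤ c)
    (hsum : ∑ a, c a = 1) {a b : κ} (hab : a ≠ b) : c a = 0 ∨ c b = 0 := by
  classical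
  have hle : c a + c b ≤ ∑ a, c a := by
    rw [← Finset.sum_pair hab]
    exact Finset.sum_le_sum_of_subset_of_nonneg (Finset.subset_univ _) fun a _ _ => hc a
  have ha : 0 ≤ c a := hc a
  have hb : 0 ≤ c b := hc b
  omega

theorem mem_or_mem_of_row_eq_sum (hA : A.det.natAbs = 1) (hface : C₀.IsFaceOf C')
    (hC₀ : C₀ ≤ faceCone A Set.univ) (hrows : ∀ l ≠ l₀, latticeHom n (A l) ∈ C₀)
    (hl₀ : A l₀ = ∑ a, α a) (hα : ∀ a, latticeHom n (α a) ∈ C') {a b : Fin m} (hab : a ≠ b) :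
    latticeHom n (α a) ∈ C₀ ∨ latticeHom n (α b) ∈ C₀ := by
  have hdet := det_ne_zero_of_natAbs_eq_one hA
  have hrow : latticeHom n (A l₀) ∈ C' := by
    rw [hl₀, map_sum]
    exact Submodule.sum_mem _ fun a _ => hα a
  have hpos (a : Fin m) (ha : latticeHom n (α a) ∉ C₀) :=
    coords_pos_of_notMem hdet hface hrows hrow (hα a) ha
  choose c hc using fun a => exists_vecMul_eq hA (α a)
  have hcoords (a : Fin m) : coords A (latticeHom n (α a)) l₀ = c a l₀ := by
    rw [← hc a, coords_latticeHom_vecMul hdet, latticeHom_apply]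
  have hnonneg (a : Fin m) : 0 ≤ c a l₀ := by
    rw [← Int.cast_nonneg_iff (R := ℝ), ← hcoords]
    by_cases ha : latticeHom n (α a) ∈ C₀
    exacts [(mem_faceCone_univ hdet).1 (hC₀ ha) l₀, (hpos a ha).le]
  have hsum : ∑ a, c a l₀ = 1 := by
    have h := congrFun (coords_row hdet l₀) l₀
    rw [hl₀, map_sum, map_sum, Finset.sum_apply, Pi.single_eq_same] at h
    simp only [hcoords] at h
    exact_mod_cast h
  refine (eq_zero_or_eq_zero_of_sum_eq_one hnonneg hsum hab).imp ?_ ?_ <;>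
  · intro hzero
    by_contra hmem
    exact (hpos _ hmem).ne' (by rw [hcoords, hzero, Int.cast_zero])

theorem mem_range_of_mem_faceCone (hA : A.det.natAbs = 1) (hα : IsPrimitiveGenerators α C)
    (hface : (C ⊓ faceCone A Set.univ).IsFaceOf (faceCone A Set.univ)) {a : Fin m}
    (ha : latticeHom n (α a) ∈ faceCone A Set.univ) : α a ∈ Set.range A := by
  have hdet := det_ne_zero_of_natAbs_eq_one hA
  have hray := ((hα.hull_image_isFaceOf {a}).inf (PointedCone.IsFaceOf.refl _)).trans hface
  obtain ⟨k, hk⟩ := exists_coords_ne_zero hdet (latticeHom_ne_zero (hα.primitive a).ne_zero)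
  have hrow := (row_mem_of_isFaceOf hdet hray
    ⟨PointedCone.subset_hull ⟨a, rfl, rfl⟩, ha⟩ hk).1
  rw [Set.image_singleton] at hrow
  obtain ⟨t, ht⟩ := Submodule.mem_span_singleton.1 hrow
  exact ⟨k, (isPrimitive_row hA k).eq_of_latticeHom_eq_smul (hα.primitive a) t.2 ht.symm⟩

theorem mem_range_or_mem_range_of_row_eq_sum [Finite ι] (hg : IsConvexFan g)
    (hdet : ∀ i, (g i).det.natAbs = 1) (hC : C ∈ R.cones) (hα : IsPrimitiveGenerators α C)
    (hT : hg.toFan.cones = R.stellarCones (latticeHom n (∑ a, α a))) {j : ι}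
    (hl₀ : g j l₀ = ∑ a, α a) {a b : Fin m} (hab : a ≠ b) :
    α a ∈ Set.range (g j) ∨ α b ∈ Set.range (g j) := by
  have hmem : faceCone (g j) Set.univ ∈ R.stellarCones (latticeHom n (∑ a, α a)) :=
    hT ▸ ⟨(j, Set.univ), rfl⟩
  rw [← hl₀] at hmem
  obtain ⟨-, hnot⟩ | ⟨C₀, hC₀, -, ⟨C', hC', hC₀C', hγ⟩, hD⟩ := hmem
  · exact absurd (row_mem_faceCone (Set.mem_univ l₀)) hnot
  have hC₀D : C₀ ≤ faceCone (g j) Set.univ :=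
    hD ▸ fun _ hx => PointedCone.subset_hull (Set.mem_insert_of_mem _ hx)
  have hDC' : faceCone (g j) Set.univ ≤ C' :=
    hD ▸ Submodule.span_le.2 (Set.insert_subset hγ hC₀C')
  have hCC' : C ≤ C' := (hα.le_of_isFaceOf_of_sum_mem (R.inf_isFaceOf_left C hC C' hC')
    ⟨hα.sum_mem, hl₀ ▸ hγ⟩).trans inf_le_right
  have hface : (C ⊓ faceCone (g j) Set.univ).IsFaceOf (faceCone (g j) Set.univ) := by
    simpa only [inf_eq_right.2 hDC'] using
      (isFaceOf_of_le hC hC' hCC').inf (PointedCone.IsFaceOf.refl (faceCone (g j) Set.univ))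
  exact (mem_or_mem_of_row_eq_sum (hdet j) (isFaceOf_of_le hC₀ hC' hC₀C') hC₀D
    (fun l => row_mem_of_faceCone_eq_hull_insert (hg.det_ne_zero j) hC₀D hD) hl₀
    (fun a => hCC' (hα.mem a)) hab).imp
    (fun h => mem_range_of_mem_faceCone (hdet j) hα hface (hC₀D h))
    (fun h => mem_range_of_mem_faceCone (hdet j) hα hface (hC₀D h))

theorem natAbs_det_substGen_patternGen {g : ι → Matrix (Fin 3) (Fin 3) ℤ}
    (hg : ∀ i, (g i).det.natAbs = 1) (p : ι × Fin 21) :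
    (substGen g patternGen p).det.natAbs = 1 := by
  rw [substGen, det_mul, Int.natAbs_mul, hg, mul_one]
  exact Int.isUnit_iff_natAbs_eq.1 (patternGen_det_isUnit _)

theorem not_isBlowUp_substGen_patternGen [Finite ι] {g : ι → Matrix (Fin 3) (Fin 3) ℤ}
    (hg : ∀ i, (g i).det.natAbs = 1) (hfan : IsConvexFan (substGen g patternGen))
    (R : PolyhedralFan 3) : ¬ hfan.toFan.IsBlowUp R := by
  rintro ⟨C, hC, m, α, hm, hα, hT⟩
  have hdet := natAbs_det_substGen_patternGen hg
  obtain ⟨⟨i, p⟩, k, hk⟩ := exists_row_eq_sum hfan hdet (by omega) hC hα hT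
  have hm3 : m ≤ 3 := by simpa using hα.1.linearIndependent.fintype_card_le_finrank
  refine sum_ne_patternGen_mul (det_ne_zero_of_natAbs_eq_one (hg i)) hm hm3 (p := p) (k := k)
    (fun a h => hα.1.ne_sum hm a (h.trans hk)) (fun a b hab t ⟨l, hl⟩ => ?_) hk.symm
  exact mem_range_or_mem_range_of_row_eq_sum hfan hdet hC hα.1 hT (j := (i, t)) (hl.trans hk) hab

end BlowUp

end PolyhedralFan

theorem mainTheorem4_general (S : PolyhedralFan 3) (hrat : S.IsRational)
    (hcomplete : S.IsComplete) :
    ∃ T : PolyhedralFan 3, T.IsUnimodular ∧ T.IsComplete ∧ T.Refines S ∧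
      (∀ R : PolyhedralFan 3, ¬ T.IsBlowUp R) ∧ T.IsPolytopal := by
  obtain ⟨ι, _, g, hg, hdet, hinj, hS⟩ :=
    PolyhedralFan.exists_unimodular_refining S hrat hcomplete
  have hfan := hg.substGen hinj PolyhedralFan.isPattern_patternGen
  refine ⟨hfan.toFan,
    hfan.toFan_isUnimodular (PolyhedralFan.natAbs_det_substGen_patternGen hdet),
    hfan.toFan_isComplete, hfan.toFan_refines fun p => ?_,
    PolyhedralFan.not_isBlowUp_substGen_patternGen hdet hfan, hfan.toFan_isPolytopal⟩
  obtain ⟨C, hC, hmem⟩ := hS p.1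
  exact ⟨C, hC, PolyhedralFan.isPattern_patternGen.latticeHom_substGen_mem hmem⟩

theorem mainTheorem4 (S : PolyhedralFan 3) (hrat : S.IsRational) (hcomplete : S.IsComplete) :
    ∃ T : PolyhedralFan 3, T.IsUnimodular ∧ T.IsComplete ∧ T.Refines S ∧
      (∀ R : PolyhedralFan 3, R.IsUnimodular → ¬ T.IsBlowUp R) ∧
      (S.IsPolytopal → T.IsPolytopal) := by
  obtain ⟨T, hT, hTc, hTS, hblow, hpoly⟩ := mainTheorem4_general S hrat hcomplete
  exact ⟨T, hT, hTc, hTS, fun R _ => hblow R, fun _ => hpoly⟩
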